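/- Let $A\in\mathbb R^{m\times n}$, $b\in\mathbb R^m$, $\mu>0$, suppose $A^*A$ is positive definite, and let $\varphi(x)=\tfrac12\|Ax-b\|_2^2+\mu\|x\|_1$ on $\mathbb R^n$. **Notation.** All norms other than $\|\cdot\|_1$ are Euclidean. For $z\in\Omega$, $\widehat N_\Omega(z)$ is the set of $v$ with $\limsup_{w\to z,\,w\in\Omega}\langle v,w-z\rangle/\|w-z\|\le 0$ (and $\widehat N_\Omega(z)=\emptyset$ if $z\notin\Omega$); $N_\Omega(z)$ is the set of limits of $v_k\in\widehat N_\Omega(z_k)$ with $z_k\to z$, $z_k\in\Omega$; $N_\Omega(z;d)$ is the set of limits of $v_k\in\widehat N_\Omega(z+t_kd_k)$ with $t_k\downarrow0$, $d_k\to d$. Put $\partial\varphi(x)=\{v:(v,-1)\in N_{\mathrm{epi}\,\varphi}(x,\varphi(x))\}$ and $\partial^2\varphi(x,y)(v)=\{w:(w,-v)\in N_{\mathrm{gph}\,\partial\varphi}(x,y)\}$ for $y\in\partial\varphi(x)$, and $\mathrm{Prox}_\lambda\varphi(x)=\operatorname{argmin}_y\{\varphi(y)+\tfrac1{2\lambda}\|y-x\|^2\}$.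 A set-valued mapping $T$ is *metrically regular* around $(\bar x,\bar y)\in\mathrm{gph}\,T$ if for some $\kappa>0$, $\mathrm{dist}(x;T^{-1}(y))\le\kappa\,\mathrm{dist}(y;T(x))$ for all $(x,y)$ near $(\bar x,\bar y)$, and *strongly* so if in addition $T^{-1}$ has a single-valued localization around $(\bar y,\bar x)$. It is *semismooth\** at $(\bar x,\bar y)$ if $\langle u^*,u\rangle=\langle v^*,v\rangle$ whenever $(u^*,-v^*)\in N_{\mathrm{gph}\,T}((\bar x,\bar y);(u,v))$. **Algorithm** (parameter $\lambda>0$). Start from $x^0\in U_\lambda:=\mathrm{rge}(I+\lambda\,\partial\varphi)$. At step $k$, stop if $0\in\partial\varphi(x^k)$; otherwise put $v^k=\tfrac1\lambda(x^k-\mathrm{Prox}_\lambda\varphi(x^k))$, choose $d^k$ with $-v^k\in\partial^2\varphi(x^k-\lambda v^k,v^k)(\lambda v^k+d^k)$, and put $x^{k+1}=x^k+d^k$. **Theorem.** 1. *(Explicit data.)* $\partial\varphi(x)=A^*(Ax-b)+\mu F(x)$ for all $x$, where $F(x)$ is the set of $v$ with $v_j=\operatorname{sgn}x_j$ if $x_j\ne0$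 and $v_j\in[-1,1]$ if $x_j=0$. For $y\in\partial\varphi(x)$ and all $v$, $\partial^2\varphi(x,y)(v)$ is the set of $w$ such that $\big(\tfrac1\mu(w-A^*Av)_i,-v_i\big)\in G\big(x_i,\tfrac1\mu(y-A^*(Ax-b))_i\big)$ for all $i$, where $G(t,p)$ is $\{0\}\times\mathbb R$ if $t\neq0$, $p\in\{-1,1\}$; $\mathbb R\times\{0\}$ if $t=0$, $p\in(-1,1)$; $(\mathbb R_+\times\mathbb R_-)\cup(\{0\}\times\mathbb R)\cup(\mathbb R\times\{0\})$ if $t=0$, $p=-1$; $(\mathbb R_-\times\mathbb R_+)\cup(\{0\}\times\mathbb R)\cup(\mathbb R\times\{0\})$ if $t=0$, $p=1$; and $\emptyset$ otherwise. If $m=n$ and $A=\mathrm{diag}(a_1,\dots,a_n)$ with all $a_i>0$, then for every $x$, $\mathrm{Prox}_1\varphi(x)$ is the single point with coordinates $\Big[\Big|\tfrac{x_i+a_ib_i}{a_i^2+1}\Big|-\tfrac{\mu}{a_i^2+1}\Big]_+\operatorname{sgn}\Big(\tfrac{x_i+a_ib_i}{a_i^2+1}\Big)$. 2. $\partial\varphi$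 is strongly metrically regular around, and semismooth\* at, every point of its graph. 3. For every $\lambda>0$, $U_\lambda=\mathbb R^n$ and $\mathrm{Prox}_\lambda\varphi$ is single-valued on $\mathbb R^n$. 4. $\varphi$ has a minimizer, and $\bar x$ minimizes $\varphi$ if and only if $0\in\partial\varphi(\bar x)$. 5. Let $\bar x$ minimize $\varphi$. Then: for all $(x,v)\in\mathrm{gph}\,\partial\varphi$ near $(\bar x,0)$ there is $d$ with $-v\in\partial^2\varphi(x,v)(d)$; $\partial\varphi$ is metrically regular around and semismooth\* at $(\bar x,0)$; $\varphi$ is bounded below by a quadratic function; $\varphi$ is subdifferentially continuous at $\bar x$ for $0$ (if $x_k\to\bar x$, $v_k\to0$, $v_k\in\partial\varphi(x_k)$, then $\varphi(x_k)\to\varphi(\bar x)$); and $\varphi$ is prox-regular at $\bar x$ for $0$ (it is lower semicontinuous around $\bar x$ and there are $\varepsilon,r>0$ with $\varphi(x)\ge\varphi(u)+\langle v,x-u\rangle-\tfrac r2\|x-u\|^2$ for all $x,u\in\mathbb B_\varepsilon(\bar x)$ with $|\varphi(u)-\varphi(\bar x)|<\varepsilon$ and all $v\in\partial\varphi(u)\cap\mathbb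 B_\varepsilon(0)$). 6. Let $\bar x$ minimize $\varphi$. For every $\lambda>0$ there is a neighborhood $U$ of $\bar x$ such that for every $x^0\in U$ the algorithm is well-defined (whatever directions have been chosen so far, it either stops or the next step can be carried out), and every sequence of iterates that it generates (continued by its last term if the algorithm stops) converges to $\bar x$ superlinearly: $\|x^{k+1}-\bar x\|=o(\|x^k-\bar x\|)$ as $k\to\infty$. -/

import Mathlib

open Set Filter Topology
open scoped Matrix ENNReal

section VariationalAnalysis

variable {H E F : Type*}
  [NormedAddCommGroup H] [InnerProductSpace ℝ H]
  [NormedAddCommGroup E] [InnerProductSpace ℝ E]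
  [NormedAddCommGroup F] [InnerProductSpace ℝ F]

/-- The regular (Fréchet) normal cone to `Ω` at `z`, i.e. all `v` with
`limsup ⟪v, w - z⟫ / ‖w - z‖ ≤ 0` as `w → z`, `w ∈ Ω`. It is empty when `z ∉ Ω`. -/
def regularNormalCone (Ω : Set H) (z : H) : Set H :=
  {v | z ∈ Ω ∧ ∀ ε : ℝ, 0 < ε → ∀ᶠ w in 𝓝[Ω] z, inner ℝ v (w - z) ≤ ε * ‖w - z‖}

/-- The limiting (Mordukhovich) normal cone to `Ω` at `z ∈ Ω`. -/
def limitingNormalCone (Ω : Set H) (z : H) : Set H :=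
  {v | z ∈ Ω ∧ ∃ (zs vs : ℕ → H), Tendsto zs atTop (𝓝 z) ∧ Tendsto vs atTop (𝓝 v) ∧
    ∀ k, vs k ∈ regularNormalCone Ω (zs k)}

/-- The directional limiting normal cone to `Ω` at `z ∈ Ω` in the direction `d`. -/
def directionalNormalCone (Ω : Set H) (z d : H) : Set H :=
  {v | z ∈ Ω ∧ ∃ (t : ℕ → ℝ) (ds vs : ℕ → H), (∀ k, 0 < t k) ∧ Tendsto t atTop (𝓝 0) ∧
    Tendsto ds atTop (𝓝 d) ∧ Tendsto vs atTop (𝓝 v) ∧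
    ∀ k, vs k ∈ regularNormalCone Ω (z + t k • ds k)}

/-- The graph of a set-valued mapping, in the product with the Euclidean (`ℓ²`) structure. -/
def gph (T : E → Set F) : Set (WithLp 2 (E × F)) :=
  {p | p.snd ∈ T p.fst}

/-- The limiting coderivative `D*T(x, y)(v)`. -/
def coderivative (T : E → Set F) (x : E) (y : F) (v : F) : Set E :=
  {u | WithLp.toLp 2 (u, -v) ∈ limitingNormalCone (gph T) (WithLp.toLp 2 (x, y))}

/-- The directional limiting coderivative `D*T((x, y); (u, v))(vs)`. -/
def directionalCoderivative (T : E → Set F) (x : E) (y : F) (u : E) (v : F) (vs : F) : Set E :=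
  {us | WithLp.toLp 2 (us, -vs) ∈
    directionalNormalCone (gph T) (WithLp.toLp 2 (x, y)) (WithLp.toLp 2 (u, v))}

/-- The epigraph of a function. -/
def epigraph (φ : E → ℝ) : Set (WithLp 2 (E × ℝ)) :=
  {p | φ p.fst ≤ p.snd}

/-- The limiting subdifferential `∂φ(x)`, through limiting normals to the epigraph. -/
def subdifferential (φ : E → ℝ) (x : E) : Set E :=
  {v | WithLp.toLp 2 (v, (-1 : ℝ)) ∈ limitingNormalCone (epigraph φ) (WithLp.toLp 2 (x, φ x))}

/-- The second-order subdifferential `∂²φ(x, v)(u) = (D*∂φ)(x, v)(u)`. -/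
def secondSubdifferential (φ : E → ℝ) (x v : E) (u : E) : Set E :=
  coderivative (subdifferential φ) x v u

/-- Metric regularity of `T` around `(x₀, y₀)` (with some modulus `κ > 0`). Distances are
extended-valued: the distance to the empty set is `∞`. -/
def IsMetricallyRegular (T : E → Set F) (x₀ : E) (y₀ : F) : Prop :=
  ∃ κ : ℝ, 0 < κ ∧ ∃ U ∈ 𝓝 x₀, ∃ V ∈ 𝓝 y₀, ∀ x ∈ U, ∀ y ∈ V,
    Metric.infEDist x {x' | y ∈ T x'} ≤ ENNReal.ofReal κ * Metric.infEDist y (T x)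

/-- Strong metric regularity of `T` around `(x₀, y₀)`: metric regularity, and the inverse mapping
has a single-valued localization around `(y₀, x₀)`. -/
def IsStronglyMetricallyRegular (T : E → Set F) (x₀ : E) (y₀ : F) : Prop :=
  IsMetricallyRegular T x₀ y₀ ∧
    ∃ U ∈ 𝓝 x₀, ∃ V ∈ 𝓝 y₀, ∀ y ∈ V, ∃! x, x ∈ U ∧ y ∈ T x

/-- The semismooth* property of `T` at `(x₀, y₀)`. -/
def IsSemismoothStar (T : E → Set F) (x₀ : E) (y₀ : F) : Prop :=
  ∀ (u : E) (v : F) (vs : F) (us : E), us ∈ directionalCoderivative T x₀ y₀ u v vs →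
    inner ℝ us u = inner ℝ vs v

/-- Robust solvability, around `(x₀, v₀)`, of the inclusion `-v ∈ ∂²φ(x, v)(d)` in `d`. -/
def IsRobustlySolvable (φ : E → ℝ) (x₀ v₀ : E) : Prop :=
  ∃ U ∈ 𝓝 x₀, ∃ V ∈ 𝓝 v₀, ∀ x ∈ U, ∀ v ∈ V, v ∈ subdifferential φ x →
    ∃ d, -v ∈ secondSubdifferential φ x v d

/-- Subdifferential continuity of `φ` at `x₀` for `v₀`. -/
def IsSubdifferentiallyContinuous (φ : E → ℝ) (x₀ v₀ : E) : Prop :=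
  ∀ xs vs : ℕ → E, Tendsto xs atTop (𝓝 x₀) → Tendsto vs atTop (𝓝 v₀) →
    (∀ k, vs k ∈ subdifferential φ (xs k)) → Tendsto (fun k => φ (xs k)) atTop (𝓝 (φ x₀))

/-- Prox-regularity of `φ` at `x₀` for `v₀`. -/
def IsProxRegular (φ : E → ℝ) (x₀ v₀ : E) : Prop :=
  (∀ᶠ x in 𝓝 x₀, LowerSemicontinuousAt φ x) ∧
    ∃ ε : ℝ, 0 < ε ∧ ∃ r : ℝ, 0 < r ∧
      ∀ x ∈ Metric.closedBall x₀ ε, ∀ u ∈ Metric.closedBall x₀ ε, |φ u - φ x₀| < ε →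
        ∀ v ∈ subdifferential φ u ∩ Metric.closedBall v₀ ε,
          φ u + inner ℝ v (x - u) - r / 2 * ‖x - u‖ ^ 2 ≤ φ x

/-- Prox-boundedness: `φ` is bounded from below by a quadratic function. -/
def IsProxBounded (φ : E → ℝ) : Prop :=
  ∃ (α : ℝ) (w : E) (c : ℝ), ∀ x, α + inner ℝ w x - c * ‖x‖ ^ 2 ≤ φ x

/-- The (set-valued) proximal mapping `Prox_λ φ (x) = argmin_y (φ y + ‖y - x‖² / (2λ))`. -/
def prox (φ : E → ℝ) (lam : ℝ) (x : E) : Set E :=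
  {p | IsMinOn (fun y => φ y + 1 / (2 * lam) * ‖y - x‖ ^ 2) univ p}

/-- The set of admissible starting points `U_λ = rge (I + λ ∂φ)`. -/
def startSet (φ : E → ℝ) (lam : ℝ) : Set E :=
  {z | ∃ x, ∃ v ∈ subdifferential φ x, z = x + lam • v}

/-- One pass of the Newton-type algorithm for `0 ∈ ∂φ(x)`, from the iterate `x` to the iterate `x'`.
If `0 ∈ ∂φ(x)` the algorithm stops, which is encoded by repeating `x` from then on.
Otherwise `v = (x - Prox_λ φ(x)) / λ`, some direction `d` with
`-v ∈ ∂²φ(x - λ v, v)(λ v + d)` is chosen, and `x' = x + d`. -/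
def NewtonIter (φ : E → ℝ) (lam : ℝ) (x x' : E) : Prop :=
  (0 ∈ subdifferential φ x ∧ x' = x) ∨
  (0 ∉ subdifferential φ x ∧ ∃ p ∈ prox φ lam x, ∃ v d : E, v = (1 / lam) • (x - p) ∧
    -v ∈ secondSubdifferential φ (x - lam • v) v (lam • v + d) ∧ x' = x + d)

/-- The algorithm is well-defined from the starting point `x₀`: `x₀` is admissible, and whatever
directions are chosen in the first `N` passes, the current proximal point exists and is unique and
the next pass can be carried out. -/
def NewtonWellDefined (φ : E → ℝ) (lam : ℝ) (x₀ : E) : Prop :=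
  x₀ ∈ startSet φ lam ∧
    ∀ (xs : ℕ → E) (N : ℕ), xs 0 = x₀ → (∀ k < N, NewtonIter φ lam (xs k) (xs (k + 1))) →
      (∃! p, p ∈ prox φ lam (xs N)) ∧ ∃ x', NewtonIter φ lam (xs N) x'

/-- Superlinear convergence, `‖x^{k+1} - x̄‖ / ‖x^k - x̄‖ → 0`, in the form that also makes sense
after a term equal to the limit. -/
def ConvergesSuperlinearly (xs : ℕ → E) (xbar : E) : Prop :=
  Tendsto xs atTop (𝓝 xbar) ∧
    (fun k => xs (k + 1) - xbar) =o[atTop] (fun k => xs k - xbar)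

end VariationalAnalysis

section Lasso

variable {m n : ℕ}

/-- The Lasso function `½‖Ax - b‖₂² + μ‖x‖₁`. -/
noncomputable def lasso (A : Matrix (Fin m) (Fin n) ℝ) (b : EuclideanSpace ℝ (Fin m)) (μ : ℝ)
    (x : EuclideanSpace ℝ (Fin n)) : ℝ :=
  1 / 2 * ‖A.toEuclideanLin x - b‖ ^ 2 + μ * ∑ i, |x i|

/-- The set `F(x)` of all `v` with `v_j = sgn x_j` if `x_j ≠ 0` and `v_j ∈ [-1, 1]` if `x_j = 0`. -/
def signSet (x : EuclideanSpace ℝ (Fin n)) : Set (EuclideanSpace ℝ (Fin n)) :=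
  {v | ∀ j, (x j ≠ 0 → v j = Real.sign (x j)) ∧ (x j = 0 → v j ∈ Icc (-1 : ℝ) 1)}

open Classical in
/-- The mapping `G : ℝ² ⇉ ℝ²` of the second-order formula. -/
noncomputable def lassoG (t p : ℝ) : Set (ℝ × ℝ) :=
  if t ≠ 0 ∧ (p = -1 ∨ p = 1) then {0} ×ˢ univ
  else if t = 0 ∧ p ∈ Ioo (-1 : ℝ) 1 then univ ×ˢ {0}
  else if t = 0 ∧ p = -1 then (Ici 0 ×ˢ Iic 0) ∪ ({0} ×ˢ univ) ∪ (univ ×ˢ {0})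
  else if t = 0 ∧ p = 1 then (Iic 0 ×ˢ Ici 0) ∪ ({0} ×ˢ univ) ∪ (univ ×ˢ {0})
  else ∅

end Lasso

/-! ### Regular normals, convex subgradients and proximal points -/

section VariationalAnalysis

variable {H E : Type*}
  [NormedAddCommGroup H] [InnerProductSpace ℝ H]
  [NormedAddCommGroup E] [InnerProductSpace ℝ E]

/-! The function is convex, so its limiting subgradients are those of convex analysis
(`mem_subdifferential_iff_of_convexOn`). Injectivity of A makes it strongly convex:
`lasso_strong_subgradient` keeps the surplus ½‖A(w - x)‖². Hence ∂φ is strongly monotone and onto,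
with a globally Lipschitz single-valued inverse, which is strong metric regularity. Quadratic growth
yields minimizers and proximal points, and monotonicity makes the proximal mapping nonexpansive.

The second-order part is geometric. With p = (y - Aᵀ(Ax - b))/μ, the affine bijection (x, y) ↦ (x,
p) carries gph ∂φ onto a product of n copies of the graph of ∂|·|, a broken line. Such a set agrees
near each of its points with a translated cone, so directional normals are orthogonal to their
direction (`IsLocalCone.inner_eq_zero`): this is semismoothness*. Normal cones are computed
coordinatewise in the plane and transported back by the adjoint.

Superlinear convergence holds in a stronger form: near the minimizer x₀, one pass lands exactly on
x₀. For a graph point (x, y) near (x₀, 0) and a Newton direction d, put e = x + d - x₀. The scalar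
inequality `eventually_newton_coord_nonneg` becomes (AᵀAe)_i e_i ≤ 0 for every i; summation gives
‖Ae‖² ≤ 0, so e = 0. The proximal step supplies such a graph point from any x near x₀. -/

theorem tendsto_ray (z h : H) : Tendsto (fun s : ℝ => z + s • h) (𝓝[>] 0) (𝓝 z) := by
  have : Tendsto (fun s : ℝ => z + s • h) (𝓝 0) (𝓝 (z + (0 : ℝ) • h)) :=
    Continuous.tendsto (by fun_prop) 0
  simp only [zero_smul, add_zero] at this
  exact this.mono_left nhdsWithin_le_nhds

/-- A regular normal makes a nonpositive product with every feasible direction. -/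
theorem inner_nonpos_of_mem_regularNormalCone {Ω : Set H} {z v h : H}
    (hv : v ∈ regularNormalCone Ω z) (hh : ∀ᶠ s : ℝ in 𝓝[>] 0, z + s • h ∈ Ω) :
    inner ℝ v h ≤ 0 := by
  have key : ∀ ε : ℝ, 0 < ε → inner ℝ v h ≤ ε * ‖h‖ := by
    intro ε hε
    have ht : Tendsto (fun s : ℝ => z + s • h) (𝓝[>] 0) (𝓝[Ω] z) :=
      tendsto_nhdsWithin_iff.2 ⟨tendsto_ray z h, hh⟩
    obtain ⟨s, hs, hs0⟩ := ((ht.eventually (hv.2 ε hε)).and self_mem_nhdsWithin).exists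
    have hs0 : 0 < s := hs0
    rw [add_sub_cancel_left, inner_smul_right, norm_smul, Real.norm_of_nonneg hs0.le] at hs
    nlinarith
  by_contra! hpos
  -- This ε makes ε‖h‖ at most half of the inner product; the added 1 covers h = 0.
  have h1 := key (inner ℝ v h / (2 * (‖h‖ + 1))) (by positivity)
  have h2 : inner ℝ v h / (2 * (‖h‖ + 1)) * ‖h‖ ≤ inner ℝ v h / 2 := by
    rw [div_mul_eq_mul_div, div_le_div_iff₀ (by positivity) (by positivity)]
    nlinarith [norm_nonneg h]
  linarith

theorem mem_regularNormalCone_of_eventually {Ω : Set H} {z v : H} (hz : z ∈ Ω)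
    (h : ∀ᶠ w in 𝓝 z, w ∈ Ω → inner ℝ v (w - z) ≤ 0) : v ∈ regularNormalCone Ω z := by
  refine ⟨hz, fun ε hε => ?_⟩
  rw [eventually_nhdsWithin_iff]
  filter_upwards [h] with w hw hwΩ
  exact (hw hwΩ).trans (by positivity)

/-- For a convex function, the limiting subdifferential is the subdifferential of convex
analysis. -/
theorem mem_subdifferential_iff_of_convexOn {φ : E → ℝ} (hφ : ConvexOn ℝ univ φ) {x v : E} :
    v ∈ subdifferential φ x ↔ ∀ w, φ x + inner ℝ v (w - x) ≤ φ w := by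
  constructor
  · rintro ⟨-, zs, vs, hzs, hvs, hN⟩ w
    -- By convexity the segment from a point of the epigraph to (w, φ w) stays in the epigraph, so
    -- it is a feasible direction. The inequality then survives the limit in k.
    have key : ∀ k, inner ℝ (vs k) (WithLp.toLp 2 (w, φ w) - zs k) ≤ 0 := by
      intro k
      refine inner_nonpos_of_mem_regularNormalCone (hN k) ?_
      filter_upwards [Ioo_mem_nhdsGT (zero_lt_one' ℝ)] with s hs
      have hz : φ (zs k).fst ≤ (zs k).snd := (hN k).1
      have hc := hφ.2 (mem_univ (zs k).fst) (mem_univ w) (sub_nonneg.2 hs.2.le) hs.1.le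
        (sub_add_cancel 1 s)
      have e1 : (zs k).fst + s • (w - (zs k).fst) = (1 - s) • (zs k).fst + s • w := by module
      change φ ((zs k).fst + s • (w - (zs k).fst)) ≤ (zs k).snd + s • (φ w - (zs k).snd)
      rw [e1]
      simp only [smul_eq_mul] at hc ⊢
      nlinarith [hs.1, hs.2]
    have hlim : Tendsto (fun k => inner ℝ (vs k) (WithLp.toLp 2 (w, φ w) - zs k)) atTop
        (𝓝 (inner ℝ (WithLp.toLp 2 (v, (-1 : ℝ))) (WithLp.toLp 2 (w, φ w) -
          WithLp.toLp 2 (x, φ x)))) := hvs.inner (tendsto_const_nhds.sub hzs)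
    have := le_of_tendsto' hlim key
    simp only [WithLp.prod_inner_apply, WithLp.ofLp_sub, Prod.fst_sub, Prod.snd_sub] at this
    simp at this
    linarith
  · intro h
    have hz : WithLp.toLp 2 (x, φ x) ∈ epigraph φ := le_refl (φ x)
    refine ⟨hz, fun _ => WithLp.toLp 2 (x, φ x), fun _ => WithLp.toLp 2 (v, (-1 : ℝ)),
      tendsto_const_nhds, tendsto_const_nhds, fun _ => ?_⟩
    refine mem_regularNormalCone_of_eventually hz (Eventually.of_forall fun w hw => ?_)
    have hw : φ w.fst ≤ w.snd := hw
    have := h w.fst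
    simp only [WithLp.prod_inner_apply, WithLp.ofLp_sub, Prod.fst_sub, Prod.snd_sub]
    simp
    linarith

theorem isMinOn_iff_zero_mem_subdifferential {φ : E → ℝ} (hφ : ConvexOn ℝ univ φ) {x : E} :
    IsMinOn φ univ x ↔ 0 ∈ subdifferential φ x := by
  rw [mem_subdifferential_iff_of_convexOn hφ]
  simp [IsMinOn, IsMinFilter]

theorem norm_sub_sq_expand (x p y : E) :
    ‖y - x‖ ^ 2 = ‖p - x‖ ^ 2 - 2 * inner ℝ (x - p) (y - p) + ‖y - p‖ ^ 2 := by
  have : y - x = (y - p) - (x - p) := by abel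
  rw [this, norm_sub_sq_real, norm_sub_rev p x, real_inner_comm]
  ring

/-- For a convex function, proximal points are characterized by the resolvent inclusion. -/
theorem mem_prox_iff_of_convexOn {φ : E → ℝ} (hφ : ConvexOn ℝ univ φ) {lam : ℝ}
    (hlam : 0 < lam) {x p : E} :
    p ∈ prox φ lam x ↔ (1 / lam) • (x - p) ∈ subdifferential φ p := by
  rw [mem_subdifferential_iff_of_convexOn hφ]
  have hp : p ∈ prox φ lam x ↔
      ∀ y, φ p + 1 / (2 * lam) * ‖p - x‖ ^ 2 ≤ φ y + 1 / (2 * lam) * ‖y - x‖ ^ 2 := by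
    simp [prox, IsMinOn, IsMinFilter]
  have e : 1 / (2 * lam) = 1 / lam / 2 := by field_simp
  have hl : 0 < 1 / lam := by positivity
  rw [hp, e]
  generalize 1 / lam = c at hl
  constructor
  · intro h y
    rw [real_inner_smul_left]
    -- Minimality is tested at p + t(y - p), convexity bounds φ there, and division by t leaves an
    -- error that vanishes with t.
    have key : ∀ t ∈ Ioo (0 : ℝ) 1,
        φ p + c * inner ℝ (x - p) (y - p) - φ y ≤ t * (c / 2 * ‖y - p‖ ^ 2) := by
      intro t ht
      have h1 := h (p + t • (y - p))
      rw [norm_sub_sq_expand x p (p + t • (y - p)), add_sub_cancel_left, inner_smul_right,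
        norm_smul, Real.norm_of_nonneg ht.1.le] at h1
      have hc := hφ.2 (mem_univ p) (mem_univ y) (sub_nonneg.2 ht.2.le) ht.1.le
        (sub_add_cancel 1 t)
      have e1 : p + t • (y - p) = (1 - t) • p + t • y := by module
      rw [e1] at h1
      simp only [smul_eq_mul] at hc
      have h3 : t * (φ p + c * inner ℝ (x - p) (y - p) - φ y) ≤
          t * (t * (c / 2 * ‖y - p‖ ^ 2)) := by
        linear_combination h1 + hc
      exact le_of_mul_le_mul_left h3 ht.1
    have hlim : Tendsto (fun t : ℝ => t * (c / 2 * ‖y - p‖ ^ 2)) (𝓝[>] 0) (𝓝 0) := by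
      have : Tendsto (fun t : ℝ => t * (c / 2 * ‖y - p‖ ^ 2)) (𝓝 0)
          (𝓝 (0 * (c / 2 * ‖y - p‖ ^ 2))) := Continuous.tendsto (by fun_prop) 0
      rw [zero_mul] at this
      exact this.mono_left nhdsWithin_le_nhds
    have := ge_of_tendsto hlim (by
      filter_upwards [Ioo_mem_nhdsGT (zero_lt_one' ℝ)] with t ht using key t ht)
    linarith
  · intro h y
    have h1 := h y
    rw [real_inner_smul_left] at h1
    rw [norm_sub_sq_expand x p y]
    nlinarith [mul_nonneg hl.le (sq_nonneg ‖y - p‖)]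

/-! ### Locally conic sets and semismoothness* -/

/-- `C` is a cone that describes the set `Ω` near the point `z`. -/
def IsLocalCone (Ω : Set H) (z : H) (C : Set H) : Prop :=
  (∀ h ∈ C, ∀ s : ℝ, 0 < s → s • h ∈ C) ∧ ∀ᶠ h in 𝓝 0, (z + h ∈ Ω ↔ h ∈ C)

/-- A whole ray of C lies in the shifted set near z, so the first-order condition becomes exact.
Convexity of C is not needed. -/
theorem IsLocalCone.mem_regularNormalCone_iff {Ω C : Set H} {z v : H} (hC : IsLocalCone Ω z C)
    (hz : z ∈ Ω) : v ∈ regularNormalCone Ω z ↔ ∀ h ∈ C, inner ℝ v h ≤ 0 := by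
  constructor
  · intro hv h hh
    refine inner_nonpos_of_mem_regularNormalCone hv ?_
    have ht := tendsto_ray (0 : H) h
    filter_upwards [ht.eventually hC.2, self_mem_nhdsWithin] with s hs hs0
    rw [zero_add] at hs
    exact hs.2 (hC.1 h hh s hs0)
  · intro h
    refine mem_regularNormalCone_of_eventually hz ?_
    have ht : Tendsto (fun w => w - z) (𝓝 z) (𝓝 0) := by
      have := Continuous.tendsto (f := fun w : H => w - z) (by fun_prop) z
      rwa [sub_self] at this
    filter_upwards [ht.eventually hC.2] with w hw hwΩ
    exact h _ (hw.1 (by rwa [add_sub_cancel]))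

/-- Directional normals to a locally conic set are orthogonal to the direction. -/
theorem IsLocalCone.inner_eq_zero {Ω C : Set H} {z d v : H} (hC : IsLocalCone Ω z C)
    (hv : v ∈ directionalNormalCone Ω z d) : inner ℝ v d = 0 := by
  obtain ⟨-, t, ds, vs, ht0, ht, hds, hvs, hN⟩ := hv
  have hlim : Tendsto (fun k => t k • ds k) atTop (𝓝 0) := by
    simpa using ht.smul hds
  have hev : ∀ᶠ k in atTop, inner ℝ (vs k) (ds k) = 0 := by
    -- The conic description is needed near z + t_k d_k, not only at that point, hence the iterated
    -- `eventually`.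
    have h2 := hC.2
    rw [← eventually_eventually_nhds] at h2
    filter_upwards [hlim.eventually h2] with k hk
    set h := t k • ds k with hh
    have hmem : h ∈ C := hk.self_of_nhds.1 (hN k).1
    -- From z + h one can move along both h and -h, since (1 + sc)h remains in the cone while 1 + sc
    -- > 0.
    have both : ∀ c : ℝ, |c| ≤ 1 → inner ℝ (vs k) (c • h) ≤ 0 := by
      intro c hc
      refine inner_nonpos_of_mem_regularNormalCone (hN k) ?_
      filter_upwards [(tendsto_ray h (c • h)).eventually hk,
        Ioo_mem_nhdsGT (zero_lt_one' ℝ)] with s hs hs0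
      rw [add_assoc]
      refine hs.2 ?_
      have : h + s • c • h = (1 + s * c) • h := by module
      rw [this]
      refine hC.1 h hmem _ ?_
      nlinarith [abs_le.1 hc, hs0.1, hs0.2]
    have h1 := both 1 (by simp)
    have h2 := both (-1) (by simp)
    rw [inner_smul_right] at h1 h2
    have h3 : inner ℝ (vs k) h = 0 := by linarith
    rw [hh, inner_smul_right] at h3
    exact (mul_eq_zero.1 h3).resolve_left (ht0 k).ne'
  exact tendsto_nhds_unique (hvs.inner hds) (tendsto_const_nhds.congr' (hev.mono fun k hk => hk.symm))

theorem isSemismoothStar_of_isLocalCone {T : E → Set H} {x : E} {y : H}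
    {C : Set (WithLp 2 (E × H))} (hC : IsLocalCone (gph T) (WithLp.toLp 2 (x, y)) C) :
    IsSemismoothStar T x y := by
  intro u v vs us h
  have := hC.inner_eq_zero h
  simp only [WithLp.prod_inner_apply, inner_neg_left] at this
  linarith

end VariationalAnalysis

section Lasso

variable {m n : ℕ} {A : Matrix (Fin m) (Fin n) ℝ} {b : EuclideanSpace ℝ (Fin m)} {μ : ℝ}

/-! ### Subgradients of the absolute value -/

/-- `(t, p)` lies on the graph of the subdifferential of the absolute value. -/
def SignRel (t p : ℝ) : Prop := (t ≠ 0 → p = Real.sign t) ∧ (t = 0 → p ∈ Icc (-1 : ℝ) 1)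

theorem SignRel.subgradient {t p : ℝ} (h : SignRel t p) (s : ℝ) : |t| + p * (s - t) ≤ |s| := by
  rcases lt_trichotomy t 0 with ht | rfl | ht
  · rw [h.1 ht.ne, Real.sign_of_neg ht, abs_of_neg ht]
    linarith [neg_le_abs s]
  · obtain ⟨h1, h2⟩ := h.2 rfl
    rcases abs_cases s with ⟨hs, _⟩ | ⟨hs, _⟩ <;> rw [hs, abs_zero] <;> nlinarith
  · rw [h.1 ht.ne', Real.sign_of_pos ht, abs_of_pos ht]
    linarith [le_abs_self s]

/-- A subgradient, up to a quadratic perturbation, of the absolute value. -/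
theorem signRel_of_subgradient {t p K : ℝ}
    (h : ∀ s, p * s ≤ |t + s| - |t| + K * s ^ 2) : SignRel t p := by
  -- Division by s > 0 and s → 0 remove the quadratic error. The bounds on p are four instances of
  -- this.
  have aux : ∀ c, (∀ᶠ s : ℝ in 𝓝[>] 0, c * s ≤ K * s ^ 2) → c ≤ 0 := by
    intro c hc
    have hlim : Tendsto (fun s : ℝ => K * s) (𝓝[>] 0) (𝓝 0) := by
      have : Tendsto (fun s : ℝ => K * s) (𝓝 0) (𝓝 (K * 0)) :=
        Continuous.tendsto (by fun_prop) 0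
      rw [mul_zero] at this
      exact this.mono_left nhdsWithin_le_nhds
    refine ge_of_tendsto hlim ?_
    filter_upwards [hc, self_mem_nhdsWithin] with s hs hs0
    have hs0 : 0 < s := hs0
    exact le_of_mul_le_mul_right (by linarith [hs]) hs0
  have hup : p - 1 ≤ 0 := aux _ (by
    filter_upwards [self_mem_nhdsWithin] with s hs0
    have hs0 : 0 < s := hs0
    have h2 := abs_add_le t s
    rw [abs_of_pos hs0] at h2
    linarith [h s])
  have hdn : -p - 1 ≤ 0 := aux _ (by
    filter_upwards [self_mem_nhdsWithin] with s hs0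
    have hs0 : 0 < s := hs0
    have h2 := abs_add_le t (-s)
    rw [abs_neg, abs_of_pos hs0] at h2
    have := h (-s)
    rw [neg_sq] at this
    linarith)
  refine ⟨fun ht => ?_, fun ht => ⟨by linarith, by linarith⟩⟩
  rcases lt_or_gt_of_ne ht with ht | ht
  · rw [Real.sign_of_neg ht]
    have : p + 1 ≤ 0 := aux _ (by
      filter_upwards [Ioo_mem_nhdsGT (neg_pos.2 ht)] with s hs
      have h2 := h s
      rw [abs_of_neg ht, abs_of_neg (by linarith [hs.2] : t + s < 0)] at h2
      linarith)
    linarith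
  · rw [Real.sign_of_pos ht]
    have : -p + 1 ≤ 0 := aux _ (by
      filter_upwards [Ioo_mem_nhdsGT ht] with s hs
      have h2 := h (-s)
      rw [abs_of_pos ht, abs_of_pos (by linarith [hs.2] : 0 < t + -s), neg_sq] at h2
      linarith)
    linarith

/-! ### The Gram operator and the subdifferential of the Lasso function -/

/-- The Gram operator `Aᵀ A`. -/
noncomputable def gram (A : Matrix (Fin m) (Fin n) ℝ) :
    EuclideanSpace ℝ (Fin n) →ₗ[ℝ] EuclideanSpace ℝ (Fin n) :=
  Aᵀ.toEuclideanLin ∘ₗ A.toEuclideanLin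

theorem inner_transpose_toEuclideanLin (u : EuclideanSpace ℝ (Fin m))
    (w : EuclideanSpace ℝ (Fin n)) :
    inner ℝ (Aᵀ.toEuclideanLin u) w = inner ℝ u (A.toEuclideanLin w) := by
  have h := Matrix.toEuclideanLin_conjTranspose_eq_adjoint A
  rw [Matrix.conjTranspose_eq_transpose_of_trivial] at h
  rw [h, LinearMap.adjoint_inner_left]

theorem inner_gram (u w : EuclideanSpace ℝ (Fin n)) :
    inner ℝ (gram A u) w = inner ℝ (A.toEuclideanLin u) (A.toEuclideanLin w) :=
  inner_transpose_toEuclideanLin _ _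

theorem inner_gram_comm (u w : EuclideanSpace ℝ (Fin n)) :
    inner ℝ (gram A u) w = inner ℝ u (gram A w) := by
  rw [inner_gram, real_inner_comm, ← inner_gram, real_inner_comm]

/-- Positive definiteness enters the remaining proof only through this injectivity. -/
theorem injective_of_posDef (hQ : (Aᵀ * A).PosDef) : Function.Injective A.toEuclideanLin := by
  rw [← LinearMap.ker_eq_bot, LinearMap.ker_eq_bot']
  intro x hx
  by_contra hne
  have h0 : (WithLp.ofLp x) ≠ 0 := fun h => hne (by ext i; simpa using congrFun h i)
  have := hQ.dotProduct_mulVec_pos h0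
  rw [← Matrix.mulVec_mulVec] at this
  have h1 : A *ᵥ (WithLp.ofLp x) = 0 := by
    have := congrArg WithLp.ofLp hx
    simpa [Matrix.toLpLin_apply] using this
  simp [h1] at this

theorem eq_zero_of_inner_gram_nonpos (hA : Function.Injective A.toEuclideanLin)
    {e : EuclideanSpace ℝ (Fin n)} (h : inner ℝ (gram A e) e ≤ 0) : e = 0 := by
  rw [inner_gram, real_inner_self_eq_norm_sq] at h
  have : ‖A.toEuclideanLin e‖ = 0 := by nlinarith [norm_nonneg (A.toEuclideanLin e)]
  exact hA (by rw [norm_eq_zero.1 this, map_zero])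

theorem lasso_expand (x w : EuclideanSpace ℝ (Fin n)) :
    lasso A b μ w - lasso A b μ x =
      inner ℝ (Aᵀ.toEuclideanLin (A.toEuclideanLin x - b)) (w - x) +
      1 / 2 * ‖A.toEuclideanLin (w - x)‖ ^ 2 + μ * ∑ i, (|w i| - |x i|) := by
  rw [inner_transpose_toEuclideanLin]
  have : A.toEuclideanLin w - b = (A.toEuclideanLin x - b) + A.toEuclideanLin (w - x) := by
    rw [map_sub]; abel
  rw [lasso, lasso, this, norm_add_sq_real, Finset.sum_sub_distrib]
  ring

theorem continuous_lasso : Continuous (lasso A b μ) := by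
  unfold lasso
  have : Continuous A.toEuclideanLin := LinearMap.continuous_of_finiteDimensional _
  fun_prop

/-- The explicit set of subgradients of the Lasso function. -/
def lassoSubgradient (A : Matrix (Fin m) (Fin n) ℝ) (b : EuclideanSpace ℝ (Fin m)) (μ : ℝ)
    (x : EuclideanSpace ℝ (Fin n)) : Set (EuclideanSpace ℝ (Fin n)) :=
  {y | ∃ v ∈ signSet x, y = Aᵀ.toEuclideanLin (A.toEuclideanLin x - b) + μ • v}

/-- The expansion around x is exact in its quadratic term, and only the ℓ¹ part is estimated,
coordinate by coordinate. The surplus is the source of both strong monotonicity and quadratic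
growth. -/
theorem lasso_strong_subgradient (hμ : 0 < μ) {x y : EuclideanSpace ℝ (Fin n)}
    (hy : y ∈ lassoSubgradient A b μ x) (w : EuclideanSpace ℝ (Fin n)) :
    lasso A b μ x + inner ℝ y (w - x) + 1 / 2 * ‖A.toEuclideanLin (w - x)‖ ^ 2 ≤
      lasso A b μ w := by
  obtain ⟨v, hv, rfl⟩ := hy
  have h := lasso_expand (A := A) (b := b) (μ := μ) x w
  have h1 : inner ℝ v (w - x) ≤ ∑ i, (|w i| - |x i|) := by
    rw [PiLp.inner_apply]
    refine Finset.sum_le_sum fun i _ => ?_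
    have := SignRel.subgradient (hv i) (w i)
    simp only [RCLike.inner_apply, conj_trivial, PiLp.sub_apply]
    linarith
  rw [inner_add_left, real_inner_smul_left]
  nlinarith

theorem exists_mem_signSet (x : EuclideanSpace ℝ (Fin n)) : ∃ v, v ∈ signSet x := by
  refine ⟨WithLp.toLp 2 fun i => Real.sign (x i), fun j => ⟨fun _ => rfl, fun h => ?_⟩⟩
  simp [h]

/-- The subgradient inequalities at the intermediate point, weighted by s and t, have linear terms
that cancel. -/
theorem convexOn_of_exists_subgradient {E : Type*} [NormedAddCommGroup E]
    [InnerProductSpace ℝ E] {φ : E → ℝ}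
    (h : ∀ x, ∃ v, ∀ w, φ x + inner ℝ v (w - x) ≤ φ w) : ConvexOn ℝ univ φ := by
  refine ⟨convex_univ, fun x _ y _ s t hs ht hst => ?_⟩
  obtain ⟨v, hv⟩ := h (s • x + t • y)
  have hx := hv x
  have hy := hv y
  obtain rfl : s = 1 - t := eq_sub_of_add_eq hst
  have e1 : x - ((1 - t) • x + t • y) = t • (x - y) := by module
  have e2 : y - ((1 - t) • x + t • y) = -((1 - t) • (x - y)) := by module
  rw [e1, real_inner_smul_right] at hx
  rw [e2, inner_neg_right, real_inner_smul_right] at hy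
  have h1 := mul_le_mul_of_nonneg_left hx hs
  have h2 := mul_le_mul_of_nonneg_left hy ht
  simp only [smul_eq_mul]
  linear_combination h1 + h2

theorem convexOn_lasso (hμ : 0 < μ) : ConvexOn ℝ univ (lasso A b μ) := by
  refine convexOn_of_exists_subgradient fun x => ?_
  obtain ⟨v, hv⟩ := exists_mem_signSet x
  refine ⟨Aᵀ.toEuclideanLin (A.toEuclideanLin x - b) + μ • v, fun w => ?_⟩
  have := lasso_strong_subgradient hμ (A := A) (b := b) ⟨v, hv, rfl⟩ w
  nlinarith [sq_nonneg ‖A.toEuclideanLin (w - x)‖]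

/-- Testing a subgradient along the coordinate lines x + s e_j leaves a scalar inequality with an
error quadratic in s, which `signRel_of_subgradient` tolerates. The converse is the strong
inequality without its surplus. -/
theorem subdifferential_lasso (hμ : 0 < μ) :
    subdifferential (lasso A b μ) = lassoSubgradient A b μ := by
  ext x y
  rw [mem_subdifferential_iff_of_convexOn (convexOn_lasso hμ)]
  constructor
  · intro h
    set g := Aᵀ.toEuclideanLin (A.toEuclideanLin x - b) with hg
    refine ⟨μ⁻¹ • (y - g), fun j => ?_, by rw [smul_inv_smul₀ hμ.ne']; abel⟩
    refine signRel_of_subgradient (K := μ⁻¹ *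
      (1 / 2 * ‖A.toEuclideanLin (EuclideanSpace.single j (1 : ℝ))‖ ^ 2)) fun s => ?_
    have h1 := h (x + s • EuclideanSpace.single j (1 : ℝ))
    have h2 := lasso_expand (A := A) (b := b) (μ := μ) x (x + s • EuclideanSpace.single j (1 : ℝ))
    have h3 : ∑ i, (|(x + s • EuclideanSpace.single j (1 : ℝ)) i| - |x i|) =
        |x j + s| - |x j| := by
      rw [Finset.sum_eq_single j]
      · simp
      · intro i _ hij
        simp [hij]
      · simp
    rw [h3, add_sub_cancel_left, map_smul, norm_smul, ← hg, inner_smul_right, mul_pow,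
      Real.norm_eq_abs, sq_abs] at h2
    rw [add_sub_cancel_left, inner_smul_right] at h1
    simp only [EuclideanSpace.inner_single_right, conj_trivial, one_mul] at h1 h2
    simp only [PiLp.smul_apply, PiLp.sub_apply, smul_eq_mul]
    have h4 : (y j - g j) * s ≤ μ * (|x j + s| - |x j|) +
        (1 / 2 * ‖A.toEuclideanLin (EuclideanSpace.single j (1 : ℝ))‖ ^ 2) * s ^ 2 := by
      linear_combination h1 + h2
    have h5 := mul_le_mul_of_nonneg_left h4 (inv_pos.2 hμ).le
    rw [mul_add, inv_mul_cancel_left₀ hμ.ne'] at h5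
    linarith
  · intro h w
    have := lasso_strong_subgradient hμ h w
    nlinarith [sq_nonneg ‖A.toEuclideanLin (w - x)‖]

/-! ### Strong monotonicity, surjectivity and strong metric regularity -/

theorem lasso_strongly_monotone (hμ : 0 < μ) {x y x' y' : EuclideanSpace ℝ (Fin n)}
    (hy : y ∈ lassoSubgradient A b μ x) (hy' : y' ∈ lassoSubgradient A b μ x') :
    ‖A.toEuclideanLin (x' - x)‖ ^ 2 ≤ inner ℝ (y' - y) (x' - x) := by
  have h1 := lasso_strong_subgradient hμ hy x'
  have h2 := lasso_strong_subgradient hμ hy' x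
  rw [← neg_sub x' x, map_neg, norm_neg, inner_neg_right] at h2
  rw [inner_sub_left]
  linarith

theorem exists_antilipschitz (hA : Function.Injective A.toEuclideanLin) :
    ∃ K : ℝ, 0 < K ∧ ∀ x, ‖x‖ ≤ K * ‖A.toEuclideanLin x‖ := by
  obtain ⟨K, hK, h⟩ := A.toEuclideanLin.exists_antilipschitzWith (LinearMap.ker_eq_bot.2 hA)
  refine ⟨K, hK, fun x => ?_⟩
  have := h.le_mul_dist x 0
  simpa using this

/-- Strong monotonicity and Cauchy–Schwarz, with ‖x‖ ≤ K‖Ax‖, give the constant K². The estimate is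
global, so regularity later holds with whole spaces as neighborhoods. -/
theorem exists_lipschitz_inverse (hμ : 0 < μ) (hA : Function.Injective A.toEuclideanLin) :
    ∃ K : ℝ, 0 < K ∧ ∀ x y x' y', y ∈ lassoSubgradient A b μ x → y' ∈ lassoSubgradient A b μ x' →
      ‖x' - x‖ ≤ K * ‖y' - y‖ := by
  obtain ⟨K, hK, h⟩ := exists_antilipschitz hA
  refine ⟨K ^ 2, by positivity, fun x y x' y' hy hy' => ?_⟩
  have h1 := lasso_strongly_monotone hμ hy hy'
  have h2 := h (x' - x)
  have h3 := real_inner_le_norm (y' - y) (x' - x)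
  have h4 : ‖x' - x‖ ^ 2 ≤ K ^ 2 * (‖y' - y‖ * ‖x' - x‖) := by
    calc ‖x' - x‖ ^ 2 ≤ (K * ‖A.toEuclideanLin (x' - x)‖) ^ 2 := by gcongr
      _ = K ^ 2 * ‖A.toEuclideanLin (x' - x)‖ ^ 2 := by ring
      _ ≤ _ := by gcongr; linarith
  rcases (norm_nonneg (x' - x)).eq_or_lt with h0 | h0
  · rw [← h0]; positivity
  · exact le_of_mul_le_mul_right (by linarith) h0

/-- A continuous function bounded below by a strictly convex quadratic attains its minimum. -/
theorem exists_isMinOn_of_quadratic_growth {g : EuclideanSpace ℝ (Fin n) → ℝ} (hg : Continuous g)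
    {α c : ℝ} {w : EuclideanSpace ℝ (Fin n)} (hc : 0 < c)
    (h : ∀ x, α + inner ℝ w x + c * ‖x‖ ^ 2 ≤ g x) : ∃ x, IsMinOn g univ x := by
  have ht : Tendsto g (cocompact _) atTop := by
    have h1 : Tendsto (fun r : ℝ => α + r * (-‖w‖ + c * r)) atTop atTop := by
      refine tendsto_atTop_add_const_left _ _ (tendsto_id.atTop_mul_atTop₀ ?_)
      exact tendsto_atTop_add_const_left _ _ (tendsto_id.const_mul_atTop hc)
    refine tendsto_atTop_mono (fun x => ?_) (h1.comp (tendsto_norm_cocompact_atTop))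
    have h2 := neg_le_of_abs_le (abs_real_inner_le_norm w x)
    have := h x
    simp only [Function.comp]
    nlinarith
  obtain ⟨x, hx⟩ := hg.exists_forall_le ht
  exact ⟨x, fun y _ => hx y⟩

theorem lasso_quadratic_growth (hμ : 0 < μ) (hA : Function.Injective A.toEuclideanLin) :
    ∃ (α c : ℝ) (w : EuclideanSpace ℝ (Fin n)), 0 < c ∧
      ∀ x, α + inner ℝ w x + c * ‖x‖ ^ 2 ≤ lasso A b μ x := by
  obtain ⟨K, hK, h⟩ := exists_antilipschitz hA
  obtain ⟨v, hv⟩ := exists_mem_signSet (0 : EuclideanSpace ℝ (Fin n))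
  refine ⟨lasso A b μ 0, 1 / 2 * (K⁻¹) ^ 2,
    Aᵀ.toEuclideanLin (A.toEuclideanLin 0 - b) + μ • v, by positivity, fun x => ?_⟩
  have h1 := lasso_strong_subgradient hμ (A := A) (b := b) ⟨v, hv, rfl⟩ x
  rw [sub_zero] at h1
  refine le_trans ?_ h1
  rw [mul_assoc, ← mul_pow]
  gcongr
  rw [inv_mul_le_iff₀ hK]
  exact h x

/-- Tilting φ by the linear form ⟨y, ·⟩ preserves quadratic growth; a minimizer of the tilted
function has y as a subgradient. -/
theorem lassoSubgradient_surjective (hμ : 0 < μ) (hA : Function.Injective A.toEuclideanLin)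
    (y : EuclideanSpace ℝ (Fin n)) : ∃ x, y ∈ lassoSubgradient A b μ x := by
  obtain ⟨α, c, w, hc, h⟩ := lasso_quadratic_growth (b := b) hμ hA
  have hcont : Continuous fun x => lasso A b μ x - inner ℝ y x :=
    continuous_lasso.sub (by fun_prop)
  obtain ⟨x, hx⟩ := exists_isMinOn_of_quadratic_growth hcont (α := α) (w := w - y) hc
    (fun x => by rw [inner_sub_left]; linarith [h x])
  refine ⟨x, ?_⟩
  rw [← subdifferential_lasso hμ, mem_subdifferential_iff_of_convexOn (convexOn_lasso hμ)]
  intro z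
  have : lasso A b μ x - inner ℝ y x ≤ lasso A b μ z - inner ℝ y z := hx (mem_univ z)
  rw [inner_sub_right]
  linarith

theorem lassoSubgradient_inverse_unique (hμ : 0 < μ) (hA : Function.Injective A.toEuclideanLin)
    {x x' y : EuclideanSpace ℝ (Fin n)} (h : y ∈ lassoSubgradient A b μ x)
    (h' : y ∈ lassoSubgradient A b μ x') : x' = x := by
  obtain ⟨K, -, hK⟩ := exists_lipschitz_inverse (b := b) hμ hA
  have := hK x y x' y h h'
  rw [sub_self, norm_zero, mul_zero] at this
  exact sub_eq_zero.1 (norm_le_zero_iff.1 this)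

theorem isStronglyMetricallyRegular_lassoSubgradient (hμ : 0 < μ)
    (hA : Function.Injective A.toEuclideanLin) (x y : EuclideanSpace ℝ (Fin n)) :
    IsStronglyMetricallyRegular (lassoSubgradient A b μ) x y := by
  constructor
  · obtain ⟨K, hK0, hK⟩ := exists_lipschitz_inverse (b := b) hμ hA
    refine ⟨K, hK0, univ, univ_mem, univ, univ_mem, fun x _ y _ => ?_⟩
    obtain ⟨z, hz⟩ := lassoSubgradient_surjective (b := b) hμ hA y
    rw [Metric.infEDist, Metric.infEDist, ENNReal.mul_iInf_of_ne (by simpa using hK0)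
      ENNReal.ofReal_ne_top]
    refine le_iInf fun y' => ?_
    rw [ENNReal.mul_iInf_of_ne (by simpa using hK0) ENNReal.ofReal_ne_top]
    refine le_iInf fun hy' => ?_
    refine (iInf₂_le z hz).trans ?_
    rw [edist_dist, edist_dist, ← ENNReal.ofReal_mul hK0.le]
    refine ENNReal.ofReal_le_ofReal ?_
    rw [dist_eq_norm, dist_eq_norm, norm_sub_rev y]
    exact hK _ _ _ _ hz hy'
  · refine ⟨univ, univ_mem, univ, univ_mem, fun y _ => ?_⟩
    obtain ⟨z, hz⟩ := lassoSubgradient_surjective (b := b) hμ hA y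
    exact ⟨z, ⟨mem_univ _, hz⟩, fun z' hz' => lassoSubgradient_inverse_unique hμ hA hz hz'.2⟩

/-! ### The proximal mapping of the Lasso function -/

theorem mem_prox_lasso_iff (hμ : 0 < μ) {lam : ℝ} (hlam : 0 < lam)
    {x p : EuclideanSpace ℝ (Fin n)} :
    p ∈ prox (lasso A b μ) lam x ↔ (1 / lam) • (x - p) ∈ lassoSubgradient A b μ p := by
  rw [mem_prox_iff_of_convexOn (convexOn_lasso hμ) hlam, subdifferential_lasso hμ]

theorem exists_mem_prox_lasso (hμ : 0 < μ) (hA : Function.Injective A.toEuclideanLin) {lam : ℝ}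
    (hlam : 0 < lam) (x : EuclideanSpace ℝ (Fin n)) : ∃ p, p ∈ prox (lasso A b μ) lam x := by
  obtain ⟨α, c, w, hc, h⟩ := lasso_quadratic_growth (b := b) hμ hA
  refine exists_isMinOn_of_quadratic_growth (α := α) (w := w) ?_ hc fun y => ?_
  · exact continuous_lasso.add (by fun_prop)
  · have : 0 ≤ 1 / (2 * lam) * ‖y - x‖ ^ 2 := by positivity
    linarith [h y]

/-- Plain monotonicity of the residuals gives ‖p' - p‖² ≤ ⟨x' - x, p' - p⟩; Cauchy–Schwarz finishes.
Uniqueness and continuity of proximal points both come from here. -/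
theorem prox_lasso_nonexpansive (hμ : 0 < μ) {lam : ℝ} (hlam : 0 < lam)
    {x p x' p' : EuclideanSpace ℝ (Fin n)} (hp : p ∈ prox (lasso A b μ) lam x)
    (hp' : p' ∈ prox (lasso A b μ) lam x') : ‖p' - p‖ ≤ ‖x' - x‖ := by
  rw [mem_prox_lasso_iff hμ hlam] at hp hp'
  have h := lasso_strongly_monotone hμ hp hp'
  rw [← smul_sub, real_inner_smul_left] at h
  have h1 : 0 ≤ inner ℝ (x' - p' - (x - p)) (p' - p) := by
    have h0 : 0 ≤ 1 / lam * inner ℝ (x' - p' - (x - p)) (p' - p) := le_trans (by positivity) h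
    exact nonneg_of_mul_nonneg_right h0 (by positivity)
  have e : x' - p' - (x - p) = (x' - x) - (p' - p) := by abel
  rw [e, inner_sub_left, real_inner_self_eq_norm_sq] at h1
  have h2 := real_inner_le_norm (x' - x) (p' - p)
  rcases (norm_nonneg (p' - p)).eq_or_lt with h0 | h0
  · rw [← h0]; positivity
  · exact le_of_mul_le_mul_right (by linarith) h0

theorem existsUnique_mem_prox_lasso (hμ : 0 < μ) (hA : Function.Injective A.toEuclideanLin)
    {lam : ℝ} (hlam : 0 < lam) (x : EuclideanSpace ℝ (Fin n)) :
    ∃! p, p ∈ prox (lasso A b μ) lam x := by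
  obtain ⟨p, hp⟩ := exists_mem_prox_lasso (b := b) hμ hA hlam x
  refine ⟨p, hp, fun p' hp' => ?_⟩
  have := prox_lasso_nonexpansive hμ hlam hp hp'
  rw [sub_self, norm_zero] at this
  exact sub_eq_zero.1 (norm_le_zero_iff.1 this)

theorem startSet_lasso (hμ : 0 < μ) (hA : Function.Injective A.toEuclideanLin) {lam : ℝ}
    (hlam : 0 < lam) : startSet (lasso A b μ) lam = univ := by
  refine eq_univ_of_forall fun x => ?_
  obtain ⟨p, hp⟩ := exists_mem_prox_lasso (b := b) hμ hA hlam x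
  refine ⟨p, _, (mem_prox_iff_of_convexOn (convexOn_lasso hμ) hlam).1 hp, ?_⟩
  rw [smul_smul, mul_one_div_cancel hlam.ne', one_smul]
  abel

/-! ### Tangents and normals to the planar graph of ∂|·| -/

theorem signRel_iff_of_pos {t p : ℝ} (ht : 0 < t) : SignRel t p ↔ p = 1 := by
  simp [SignRel, ht.ne', Real.sign_of_pos ht]

theorem signRel_iff_of_neg {t p : ℝ} (ht : t < 0) : SignRel t p ↔ p = -1 := by
  simp [SignRel, ht.ne, Real.sign_of_neg ht]

theorem signRel_zero_iff {p : ℝ} : SignRel 0 p ↔ -1 ≤ p ∧ p ≤ 1 := by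
  simp [SignRel]

/-- The five local types of points on the graph of the subdifferential of the absolute value. -/
theorem SignRel.cases {t p : ℝ} (h : SignRel t p) :
    (0 < t ∧ p = 1) ∨ (t < 0 ∧ p = -1) ∨ (t = 0 ∧ -1 < p ∧ p < 1) ∨ (t = 0 ∧ p = 1) ∨
      (t = 0 ∧ p = -1) := by
  rcases lt_trichotomy t 0 with ht | rfl | ht
  · exact Or.inr (Or.inl ⟨ht, (signRel_iff_of_neg ht).1 h⟩)
  · obtain ⟨h1, h2⟩ := signRel_zero_iff.1 h
    rcases h1.lt_or_eq with h1 | h1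
    · rcases h2.lt_or_eq with h2 | h2
      · exact Or.inr (Or.inr (Or.inl ⟨rfl, h1, h2⟩))
      · exact Or.inr (Or.inr (Or.inr (Or.inl ⟨rfl, h2⟩)))
    · exact Or.inr (Or.inr (Or.inr (Or.inr ⟨rfl, h1.symm⟩)))
  · exact Or.inl ⟨ht, (signRel_iff_of_pos ht).1 h⟩

/-- The tangent cone to the graph of the subdifferential of the absolute value at `(t, p)`. -/
def signTangent (t p : ℝ) : Set (ℝ × ℝ) :=
  {h | (t ≠ 0 → h.2 = 0) ∧ (t = 0 → -1 < p → p < 1 → h.1 = 0) ∧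
    (t = 0 → p = 1 → (0 ≤ h.1 ∧ h.2 = 0) ∨ (h.1 = 0 ∧ h.2 ≤ 0)) ∧
    (t = 0 → p = -1 → (h.1 ≤ 0 ∧ h.2 = 0) ∨ (h.1 = 0 ∧ 0 ≤ h.2))}

theorem zero_mem_signTangent (t p : ℝ) : (0 : ℝ × ℝ) ∈ signTangent t p := by
  simp [signTangent]

theorem smul_mem_signTangent {t p : ℝ} {h : ℝ × ℝ} (hh : h ∈ signTangent t p) {s : ℝ}
    (hs : 0 < s) : s • h ∈ signTangent t p := by
  obtain ⟨h1, h2, h3, h4⟩ := hh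
  refine ⟨fun ht => by simp [h1 ht], fun ht hp hp' => by simp [h2 ht hp hp'], fun ht hp => ?_,
    fun ht hp => ?_⟩
  · rcases h3 ht hp with ⟨h5, h6⟩ | ⟨h5, h6⟩
    · exact Or.inl ⟨mul_nonneg hs.le h5, by simp [h6]⟩
    · exact Or.inr ⟨by simp [h5], mul_nonpos_of_nonneg_of_nonpos hs.le h6⟩
  · rcases h4 ht hp with ⟨h5, h6⟩ | ⟨h5, h6⟩
    · exact Or.inl ⟨mul_nonpos_of_nonneg_of_nonpos hs.le h5, by simp [h6]⟩
    · exact Or.inr ⟨by simp [h5], mul_nonneg hs.le h6⟩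

/-- The graph consists of two horizontal rays and a vertical segment. Near a point it is a line, or
at a corner two rays, so the tangent cone describes it exactly. -/
theorem eventually_signRel_iff {t p : ℝ} (h : SignRel t p) :
    ∀ᶠ q : ℝ × ℝ in 𝓝 0, (SignRel (t + q.1) (p + q.2) ↔ q ∈ signTangent t p) := by
  have c1 : Tendsto (fun q : ℝ × ℝ => t + q.1) (𝓝 0) (𝓝 t) := by
    simpa using Continuous.tendsto (f := fun q : ℝ × ℝ => t + q.1) (by fun_prop) 0
  have c2 : Tendsto (fun q : ℝ × ℝ => p + q.2) (𝓝 0) (𝓝 p) := by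
    simpa using Continuous.tendsto (f := fun q : ℝ × ℝ => p + q.2) (by fun_prop) 0
  rcases h.cases with ⟨ht, rfl⟩ | ⟨ht, rfl⟩ | ⟨rfl, hp1, hp2⟩ | ⟨rfl, rfl⟩ | ⟨rfl, rfl⟩
  · filter_upwards [c1.eventually_const_lt ht] with q hq
    rw [signRel_iff_of_pos hq]
    simp [signTangent, ht.ne']
  · filter_upwards [c1.eventually_lt_const ht] with q hq
    rw [signRel_iff_of_neg hq]
    simp [signTangent, ht.ne]
  · filter_upwards [c2.eventually_const_lt hp1, c2.eventually_lt_const hp2] with q hq1 hq2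
    rcases lt_trichotomy q.1 0 with h0 | h0 | h0
    · rw [zero_add, signRel_iff_of_neg h0]
      simp [signTangent, hp1, hp2, hp1.ne', hp2.ne, h0.ne, hq1.ne']
    · rw [zero_add, h0, signRel_zero_iff]
      simp [signTangent, hp1, hp2, hp1.ne', hp2.ne, h0, hq1.le, hq2.le]
    · rw [zero_add, signRel_iff_of_pos h0]
      simp [signTangent, hp1, hp2, hp1.ne', hp2.ne, h0.ne', hq2.ne]
  · filter_upwards [c2.eventually_const_lt (show (-1 : ℝ) < 1 by norm_num)] with q hq1
    have e : q ∈ signTangent 0 1 ↔ (0 ≤ q.1 ∧ q.2 = 0) ∨ (q.1 = 0 ∧ q.2 ≤ 0) := by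
      simp only [signTangent, mem_ofPred_eq]; norm_num
    rw [e, zero_add]
    rcases lt_trichotomy q.1 0 with h0 | h0 | h0
    · rw [signRel_iff_of_neg h0]
      simp [h0.ne, h0, hq1.ne']
    · rw [h0, signRel_zero_iff]
      constructor
      · rintro ⟨-, h2⟩; exact Or.inr ⟨rfl, by linarith⟩
      · rintro (⟨-, h2⟩ | ⟨-, h2⟩) <;> constructor <;> linarith
    · rw [signRel_iff_of_pos h0]
      simp [h0.ne', h0.le]
  · filter_upwards [c2.eventually_lt_const (show (-1 : ℝ) < 1 by norm_num)] with q hq1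
    have e : q ∈ signTangent 0 (-1) ↔ (q.1 ≤ 0 ∧ q.2 = 0) ∨ (q.1 = 0 ∧ 0 ≤ q.2) := by
      simp only [signTangent, mem_ofPred_eq]; norm_num
    rw [e, zero_add]
    rcases lt_trichotomy q.1 0 with h0 | h0 | h0
    · rw [signRel_iff_of_neg h0]
      simp [h0.ne, h0.le]
    · rw [h0, signRel_zero_iff]
      constructor
      · rintro ⟨h2, -⟩; exact Or.inr ⟨rfl, by linarith⟩
      · rintro (⟨-, h2⟩ | ⟨-, h2⟩) <;> constructor <;> linarith
    · rw [signRel_iff_of_pos h0]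
      simp [h0.ne', h0, hq1.ne]

/-- The regular normal cone to the graph of the subdifferential of the absolute value. -/
def signPolar (t p : ℝ) : Set (ℝ × ℝ) :=
  {q | ∀ h ∈ signTangent t p, q.1 * h.1 + q.2 * h.2 ≤ 0}

theorem mem_signPolar_iff_of_ne {t p : ℝ} {q : ℝ × ℝ} (ht : t ≠ 0) :
    q ∈ signPolar t p ↔ q.1 = 0 := by
  constructor
  · intro h
    have := h (q.1, 0) (by simp [signTangent, ht])
    nlinarith [sq_nonneg q.1]
  · intro h k hk
    rw [h, hk.1 ht]; simp

theorem mem_signPolar_iff_of_mem_Ioo {p : ℝ} {q : ℝ × ℝ} (h1 : -1 < p) (h2 : p < 1) :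
    q ∈ signPolar 0 p ↔ q.2 = 0 := by
  constructor
  · intro h
    have := h (0, q.2) (by simp [signTangent, h1.ne', h2.ne])
    nlinarith [sq_nonneg q.2]
  · intro h k hk
    rw [h, hk.2.1 rfl h1 h2]; simp

theorem mem_signPolar_one_iff {q : ℝ × ℝ} : q ∈ signPolar 0 1 ↔ q.1 ≤ 0 ∧ 0 ≤ q.2 := by
  constructor
  · intro h
    -- The test vectors generate the two rays that meet at the corner.
    have h1 := h (1, 0) (by simp only [signTangent, mem_ofPred_eq]; norm_num)
    have h2 := h (0, -1) (by simp only [signTangent, mem_ofPred_eq]; norm_num)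
    constructor <;> linarith
  · rintro ⟨h1, h2⟩ k hk
    rcases hk.2.2.1 rfl rfl with ⟨h3, h4⟩ | ⟨h3, h4⟩
    · rw [h4]; nlinarith
    · rw [h3]; nlinarith

theorem mem_signPolar_neg_one_iff {q : ℝ × ℝ} : q ∈ signPolar 0 (-1) ↔ 0 ≤ q.1 ∧ q.2 ≤ 0 := by
  constructor
  · intro h
    have h1 := h (-1, 0) (by simp only [signTangent, mem_ofPred_eq]; norm_num)
    have h2 := h (0, 1) (by simp only [signTangent, mem_ofPred_eq]; norm_num)
    constructor <;> linarith
  · rintro ⟨h1, h2⟩ k hk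
    rcases hk.2.2.2 rfl rfl with ⟨h3, h4⟩ | ⟨h3, h4⟩
    · rw [h4]; nlinarith
    · rw [h3]; nlinarith

theorem lassoG_of_ne {t p : ℝ} (ht : t ≠ 0) (hp : p = -1 ∨ p = 1) :
    lassoG t p = {q | q.1 = 0} := by
  ext q; rw [lassoG, if_pos ⟨ht, hp⟩]; simp

theorem lassoG_of_mem_Ioo {p : ℝ} (h1 : -1 < p) (h2 : p < 1) : lassoG 0 p = {q | q.2 = 0} := by
  ext q; rw [lassoG, if_neg (by simp), if_pos ⟨rfl, h1, h2⟩]; simp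

theorem lassoG_neg_one :
    lassoG 0 (-1) = {q | 0 ≤ q.1 ∧ q.2 ≤ 0} ∪ {q | q.1 = 0} ∪ {q | q.2 = 0} := by
  ext q; rw [lassoG, if_neg (by simp), if_neg (by simp), if_pos ⟨rfl, rfl⟩]; simp

theorem lassoG_one :
    lassoG 0 1 = {q | q.1 ≤ 0 ∧ 0 ≤ q.2} ∪ {q | q.1 = 0} ∪ {q | q.2 = 0} := by
  ext q
  rw [lassoG, if_neg (by simp), if_neg (by simp), if_neg (by norm_num), if_pos ⟨rfl, rfl⟩]; simp

theorem isClosed_lassoG {t p : ℝ} (h : SignRel t p) : IsClosed (lassoG t p) := by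
  have c1 : IsClosed {q : ℝ × ℝ | q.1 = 0} := isClosed_eq continuous_fst continuous_const
  have c2 : IsClosed {q : ℝ × ℝ | q.2 = 0} := isClosed_eq continuous_snd continuous_const
  rcases h.cases with ⟨ht, rfl⟩ | ⟨ht, rfl⟩ | ⟨rfl, hp1, hp2⟩ | ⟨rfl, rfl⟩ | ⟨rfl, rfl⟩
  · rwa [lassoG_of_ne ht.ne' (Or.inr rfl)]
  · rwa [lassoG_of_ne ht.ne (Or.inl rfl)]
  · rwa [lassoG_of_mem_Ioo hp1 hp2]
  · rw [lassoG_one]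
    exact (((isClosed_le continuous_fst continuous_const).inter
      (isClosed_le continuous_const continuous_snd)).union c1).union c2
  · rw [lassoG_neg_one]
    exact (((isClosed_le continuous_const continuous_fst).inter
      (isClosed_le continuous_snd continuous_const)).union c1).union c2

/-- Regular normals at nearby points of the graph lie in the limiting normal cone. -/
theorem eventually_signPolar_subset {t p : ℝ} (h : SignRel t p) :
    ∀ᶠ z : ℝ × ℝ in 𝓝 (t, p), SignRel z.1 z.2 → signPolar z.1 z.2 ⊆ lassoG t p := by
  have c1 : Tendsto (fun q : ℝ × ℝ => q.1) (𝓝 (t, p)) (𝓝 t) := continuous_fst.tendsto (t, p)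
  have c2 : Tendsto (fun q : ℝ × ℝ => q.2) (𝓝 (t, p)) (𝓝 p) := continuous_snd.tendsto (t, p)
  rcases h.cases with ⟨ht, rfl⟩ | ⟨ht, rfl⟩ | ⟨rfl, hp1, hp2⟩ | ⟨rfl, rfl⟩ | ⟨rfl, rfl⟩
  · filter_upwards [c1.eventually_const_lt ht] with z hz _ q hq
    rw [lassoG_of_ne ht.ne' (Or.inr rfl)]
    exact (mem_signPolar_iff_of_ne hz.ne').1 hq
  · filter_upwards [c1.eventually_lt_const ht] with z hz _ q hq
    rw [lassoG_of_ne ht.ne (Or.inl rfl)]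
    exact (mem_signPolar_iff_of_ne hz.ne).1 hq
  · filter_upwards [c2.eventually_const_lt hp1, c2.eventually_lt_const hp2] with z hz1 hz2 hz q hq
    rw [lassoG_of_mem_Ioo hp1 hp2]
    have h0 : z.1 = 0 := by
      rcases hz.cases with h | h | h | h | h <;> first | exact h.1 | (exfalso; linarith [h.2])
    rw [h0] at hq
    exact (mem_signPolar_iff_of_mem_Ioo hz1 hz2).1 hq
  · filter_upwards [c2.eventually_const_lt (show (-1 : ℝ) < 1 by norm_num)] with z hz1 hz q hq
    rw [lassoG_one]
    -- Near the corner (0, 1), horizontal points, vertical points and the corner itself supply the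
    -- three pieces of `lassoG`.
    rcases hz.cases with ⟨h1, -⟩ | ⟨h1, -⟩ | ⟨h1, h2, h3⟩ | ⟨h1, h2⟩ | ⟨-, h2⟩
    · exact Or.inl (Or.inr ((mem_signPolar_iff_of_ne h1.ne').1 hq))
    · exact Or.inl (Or.inr ((mem_signPolar_iff_of_ne h1.ne).1 hq))
    · rw [h1] at hq
      exact Or.inr ((mem_signPolar_iff_of_mem_Ioo h2 h3).1 hq)
    · rw [h1, h2] at hq
      exact Or.inl (Or.inl (mem_signPolar_one_iff.1 hq))
    · exact absurd h2 hz1.ne'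
  · filter_upwards [c2.eventually_lt_const (show (-1 : ℝ) < 1 by norm_num)] with z hz1 hz q hq
    rw [lassoG_neg_one]
    rcases hz.cases with ⟨h1, -⟩ | ⟨h1, -⟩ | ⟨h1, h2, h3⟩ | ⟨-, h2⟩ | ⟨h1, h2⟩
    · exact Or.inl (Or.inr ((mem_signPolar_iff_of_ne h1.ne').1 hq))
    · exact Or.inl (Or.inr ((mem_signPolar_iff_of_ne h1.ne).1 hq))
    · rw [h1] at hq
      exact Or.inr ((mem_signPolar_iff_of_mem_Ioo h2 h3).1 hq)
    · exact absurd h2 hz1.ne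
    · rw [h1, h2] at hq
      exact Or.inl (Or.inl (mem_signPolar_neg_one_iff.1 hq))

/-- The normal q is kept fixed and only the base point moves: at a corner, it stays put or slides
along the horizontal or the vertical piece, according to the part of `lassoG` that contains q. -/
theorem exists_seq_mem_signPolar {t p : ℝ} {q : ℝ × ℝ} (h : SignRel t p) (hq : q ∈ lassoG t p) :
    ∃ ts ps : ℕ → ℝ, Tendsto ts atTop (𝓝 t) ∧ Tendsto ps atTop (𝓝 p) ∧
      ∀ k, SignRel (ts k) (ps k) ∧ q ∈ signPolar (ts k) (ps k) := by
  have hone := tendsto_one_div_add_atTop_nhds_zero_nat (𝕜 := ℝ)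
  have hpos : ∀ k : ℕ, (0 : ℝ) < 1 / ((k : ℝ) + 1) := fun k => by positivity
  have hle : ∀ k : ℕ, 1 / ((k : ℝ) + 1) ≤ 1 := fun k => by
    rw [div_le_one (by positivity)]; linarith [(Nat.cast_nonneg k : (0 : ℝ) ≤ k)]
  have const : q ∈ signPolar t p → ∃ ts ps : ℕ → ℝ, Tendsto ts atTop (𝓝 t) ∧
      Tendsto ps atTop (𝓝 p) ∧ ∀ k, SignRel (ts k) (ps k) ∧ q ∈ signPolar (ts k) (ps k) :=
    fun hq => ⟨fun _ => t, fun _ => p, tendsto_const_nhds, tendsto_const_nhds, fun _ => ⟨h, hq⟩⟩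
  rcases h.cases with ⟨ht, rfl⟩ | ⟨ht, rfl⟩ | ⟨rfl, hp1, hp2⟩ | ⟨rfl, rfl⟩ | ⟨rfl, rfl⟩
  · rw [lassoG_of_ne ht.ne' (Or.inr rfl)] at hq
    exact const ((mem_signPolar_iff_of_ne ht.ne').2 hq)
  · rw [lassoG_of_ne ht.ne (Or.inl rfl)] at hq
    exact const ((mem_signPolar_iff_of_ne ht.ne).2 hq)
  · rw [lassoG_of_mem_Ioo hp1 hp2] at hq
    exact const ((mem_signPolar_iff_of_mem_Ioo hp1 hp2).2 hq)
  · rw [lassoG_one] at hq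
    rcases hq with (hq | hq) | hq
    · exact const (mem_signPolar_one_iff.2 hq)
    · exact ⟨fun k => 1 / ((k : ℝ) + 1), fun _ => 1, hone, tendsto_const_nhds, fun k =>
        ⟨(signRel_iff_of_pos (hpos k)).2 rfl, (mem_signPolar_iff_of_ne (hpos k).ne').2 hq⟩⟩
    · refine ⟨fun _ => 0, fun k => 1 - 1 / ((k : ℝ) + 1), tendsto_const_nhds, ?_, fun k =>
        ⟨signRel_zero_iff.2 ⟨by linarith [hle k], by linarith [hpos k]⟩,
          (mem_signPolar_iff_of_mem_Ioo (by linarith [hle k]) (by linarith [hpos k])).2 hq⟩⟩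
      simpa using hone.const_sub 1
  · rw [lassoG_neg_one] at hq
    rcases hq with (hq | hq) | hq
    · exact const (mem_signPolar_neg_one_iff.2 hq)
    · refine ⟨fun k => -(1 / ((k : ℝ) + 1)), fun _ => -1, ?_, tendsto_const_nhds, fun k =>
        ⟨(signRel_iff_of_neg (by linarith [hpos k])).2 rfl,
          (mem_signPolar_iff_of_ne (by linarith [hpos k])).2 hq⟩⟩
      simpa using hone.neg
    · refine ⟨fun _ => 0, fun k => -1 + 1 / ((k : ℝ) + 1), tendsto_const_nhds, ?_, fun k =>
        ⟨signRel_zero_iff.2 ⟨by linarith [hpos k], by linarith [hle k]⟩,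
          (mem_signPolar_iff_of_mem_Ioo (by linarith [hpos k]) (by linarith [hle k])).2 hq⟩⟩
      simpa using hone.const_add (-1)

/-! ### Scalar Newton inequality and soft thresholding -/

/-- Graph points near (t₀, p₀) lie on pieces through (t₀, p₀). On a horizontal piece p = p₀ and a =
0; on the vertical one t = t₀ and d = 0, so the product vanishes. At a corner, which is then (t₀,
p₀) itself, it equals ad, and the signs in `lassoG` make that nonnegative. -/
theorem eventually_newton_coord_nonneg {t₀ p₀ : ℝ} (h : SignRel t₀ p₀) :
    ∀ᶠ z : ℝ × ℝ in 𝓝 (t₀, p₀), SignRel z.1 z.2 → ∀ a d, (a, -d) ∈ lassoG z.1 z.2 →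
      0 ≤ (a + (z.2 - p₀)) * (z.1 + d - t₀) := by
  have c1 : Tendsto (fun q : ℝ × ℝ => q.1) (𝓝 (t₀, p₀)) (𝓝 t₀) := continuous_fst.tendsto _
  have c2 : Tendsto (fun q : ℝ × ℝ => q.2) (𝓝 (t₀, p₀)) (𝓝 p₀) := continuous_snd.tendsto _
  rcases h.cases with ⟨ht, rfl⟩ | ⟨ht, rfl⟩ | ⟨rfl, hp1, hp2⟩ | ⟨rfl, rfl⟩ | ⟨rfl, rfl⟩
  · filter_upwards [c1.eventually_const_lt ht] with z hz hr a d hG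
    have e := (signRel_iff_of_pos hz).1 hr
    rw [lassoG_of_ne hz.ne' (Or.inr e)] at hG
    have hG : a = 0 := hG
    simp [hG, e]
  · filter_upwards [c1.eventually_lt_const ht] with z hz hr a d hG
    have e := (signRel_iff_of_neg hz).1 hr
    rw [lassoG_of_ne hz.ne (Or.inl e)] at hG
    have hG : a = 0 := hG
    simp [hG, e]
  · filter_upwards [c2.eventually_const_lt hp1, c2.eventually_lt_const hp2] with z hz1 hz2 hr a d hG
    have h0 : z.1 = 0 := by
      rcases hr.cases with h | h | h | h | h <;> first | exact h.1 | (exfalso; linarith [h.2])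
    rw [h0, lassoG_of_mem_Ioo hz1 hz2] at hG
    have hG : -d = 0 := hG
    simp [neg_eq_zero.1 hG, h0]
  · filter_upwards [c2.eventually_const_lt (show (-1 : ℝ) < 1 by norm_num)] with z hz1 hr a d hG
    rcases hr.cases with ⟨h1, h2⟩ | ⟨h1, h2⟩ | ⟨h1, h2, h3⟩ | ⟨h1, h2⟩ | ⟨-, h2⟩
    · rw [lassoG_of_ne h1.ne' (Or.inr h2)] at hG
      have hG : a = 0 := hG
      simp [hG, h2]
    · exact absurd h2 hz1.ne'
    · rw [h1, lassoG_of_mem_Ioo h2 h3] at hG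
      have hG : -d = 0 := hG
      simp [neg_eq_zero.1 hG, h1]
    · rw [h1, h2, lassoG_one] at hG
      rw [h1, h2, sub_self, add_zero, zero_add, sub_zero]
      rcases hG with (hG | hG) | hG
      · have h3 : a ≤ 0 := hG.1
        have h4 : 0 ≤ -d := hG.2
        nlinarith
      · have hG : a = 0 := hG
        simp [hG]
      · have hG : -d = 0 := hG
        simp [neg_eq_zero.1 hG]
    · exact absurd h2 hz1.ne'
  · filter_upwards [c2.eventually_lt_const (show (-1 : ℝ) < 1 by norm_num)] with z hz1 hr a d hG
    rcases hr.cases with ⟨h1, h2⟩ | ⟨h1, h2⟩ | ⟨h1, h2, h3⟩ | ⟨-, h2⟩ | ⟨h1, h2⟩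
    · exact absurd h2 hz1.ne
    · rw [lassoG_of_ne h1.ne (Or.inl h2)] at hG
      have hG : a = 0 := hG
      simp [hG, h2]
    · rw [h1, lassoG_of_mem_Ioo h2 h3] at hG
      have hG : -d = 0 := hG
      simp [neg_eq_zero.1 hG, h1]
    · exact absurd h2 hz1.ne
    · rw [h1, h2, lassoG_neg_one] at hG
      rw [h1, h2, sub_self, add_zero, zero_add, sub_zero]
      rcases hG with (hG | hG) | hG
      · have h3 : 0 ≤ a := hG.1
        have h4 : -d ≤ 0 := hG.2
        nlinarith
      · have hG : a = 0 := hG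
        simp [hG]
      · have hG : -d = 0 := hG
        simp [neg_eq_zero.1 hG]

theorem signRel_iff_eq_soft_threshold {c ν p : ℝ} (hν : 0 < ν) :
    SignRel p ((c - p) / ν) ↔ p = max (|c| - ν) 0 * Real.sign c := by
  rcases lt_trichotomy p 0 with hp | rfl | hp
  · rw [signRel_iff_of_neg hp, div_eq_iff hν.ne']
    constructor
    · intro h
      have hc : c < 0 := by linarith
      rw [Real.sign_of_neg hc, abs_of_neg hc, max_eq_left (by linarith)]
      linarith
    · intro h
      have h0 := le_max_right (|c| - ν) 0
      rcases lt_trichotomy c 0 with hc | rfl | hc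
      · rw [Real.sign_of_neg hc] at h
        rcases max_cases (|c| - ν) 0 with ⟨h1, -⟩ | ⟨h1, -⟩ <;> rw [h1] at h
        · rw [abs_of_neg hc] at h; linarith
        · linarith
      · rw [Real.sign_zero] at h; linarith
      · rw [Real.sign_of_pos hc] at h; linarith
  · rw [signRel_zero_iff, sub_zero, le_div_iff₀ hν, div_le_iff₀ hν]
    constructor
    · rintro ⟨h1, h2⟩
      have hc : |c| ≤ ν := abs_le.2 ⟨by linarith, by linarith⟩
      rw [max_eq_right (by linarith), zero_mul]
    · intro h
      by_contra hcon
      have hlt : ν < |c| := by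
        by_contra! h1
        exact hcon ⟨by linarith [(abs_le.1 h1).1], by linarith [(abs_le.1 h1).2]⟩
      have hc : c ≠ 0 := abs_pos.1 (hν.trans hlt)
      rw [max_eq_left (by linarith)] at h
      rcases mul_eq_zero.1 h.symm with h1 | h1
      · linarith
      · exact hc (Real.sign_eq_zero_iff.1 h1)
  · rw [signRel_iff_of_pos hp, div_eq_iff hν.ne']
    constructor
    · intro h
      have hc : 0 < c := by linarith
      rw [Real.sign_of_pos hc, abs_of_pos hc, max_eq_left (by linarith)]
      linarith
    · intro h
      have h0 := le_max_right (|c| - ν) 0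
      rcases lt_trichotomy c 0 with hc | rfl | hc
      · rw [Real.sign_of_neg hc] at h; linarith
      · rw [Real.sign_zero] at h; linarith
      · rw [Real.sign_of_pos hc] at h
        rcases max_cases (|c| - ν) 0 with ⟨h1, -⟩ | ⟨h1, -⟩ <;> rw [h1] at h
        · rw [abs_of_pos hc] at h; linarith
        · linarith

/-! ### Normal cones to the graph of the Lasso subdifferential -/

/-- The sign vector `(y - Aᵀ (A x - b)) / μ` that belongs to a subgradient `y` at `x`. -/
noncomputable def lassoSlope (A : Matrix (Fin m) (Fin n) ℝ) (b : EuclideanSpace ℝ (Fin m)) (μ : ℝ)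
    (x y : EuclideanSpace ℝ (Fin n)) : EuclideanSpace ℝ (Fin n) :=
  (1 / μ) • (y - Aᵀ.toEuclideanLin (A.toEuclideanLin x - b))

theorem mem_lassoSubgradient_iff (hμ : 0 < μ) {x y : EuclideanSpace ℝ (Fin n)} :
    y ∈ lassoSubgradient A b μ x ↔ ∀ i, SignRel (x i) (lassoSlope A b μ x y i) := by
  constructor
  · rintro ⟨v, hv, rfl⟩
    have : lassoSlope A b μ x (Aᵀ.toEuclideanLin (A.toEuclideanLin x - b) + μ • v) = v := by
      rw [lassoSlope, add_sub_cancel_left, smul_smul, one_div_mul_cancel hμ.ne', one_smul]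
    rwa [this]
  · intro h
    refine ⟨lassoSlope A b μ x y, h, ?_⟩
    rw [lassoSlope, smul_smul, mul_one_div_cancel hμ.ne', one_smul]
    abel

/-- The change of coordinates (x, y) ↦ (x, slope) is affine, so increments are transformed linearly.
-/
theorem lassoSlope_add (x y ξ η : EuclideanSpace ℝ (Fin n)) :
    lassoSlope A b μ (x + ξ) (y + η) = lassoSlope A b μ x y + (1 / μ) • (η - gram A ξ) := by
  rw [lassoSlope, lassoSlope, ← smul_add]
  congr 1
  simp only [gram, LinearMap.comp_apply, map_add, map_sub]
  abel

theorem continuous_gram : Continuous (gram A) := LinearMap.continuous_of_finiteDimensional _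

theorem continuous_lassoSlope :
    Continuous fun z : EuclideanSpace ℝ (Fin n) × EuclideanSpace ℝ (Fin n) =>
      lassoSlope A b μ z.1 z.2 := by
  unfold lassoSlope
  have h1 : Continuous A.toEuclideanLin := LinearMap.continuous_of_finiteDimensional _
  have h2 : Continuous Aᵀ.toEuclideanLin := LinearMap.continuous_of_finiteDimensional _
  fun_prop

/-- The tangent cone to the graph of the subdifferential of the Lasso function. -/
def lassoTangent (A : Matrix (Fin m) (Fin n) ℝ) (b : EuclideanSpace ℝ (Fin m)) (μ : ℝ)
    (x y : EuclideanSpace ℝ (Fin n)) :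
    Set (WithLp 2 (EuclideanSpace ℝ (Fin n) × EuclideanSpace ℝ (Fin n))) :=
  {h | ∀ i, (h.fst i, ((1 / μ) • (h.snd - gram A h.fst)) i) ∈
    signTangent (x i) (lassoSlope A b μ x y i)}

theorem isLocalCone_lassoTangent (hμ : 0 < μ) {x y : EuclideanSpace ℝ (Fin n)}
    (hy : y ∈ lassoSubgradient A b μ x) :
    IsLocalCone (gph (lassoSubgradient A b μ)) (WithLp.toLp 2 (x, y)) (lassoTangent A b μ x y) := by
  rw [mem_lassoSubgradient_iff hμ] at hy
  constructor
  · intro h hh s hs i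
    have := smul_mem_signTangent (hh i) hs
    have e : (1 / μ) • ((s • h).snd - gram A (s • h).fst) =
        s • ((1 / μ) • (h.snd - gram A h.fst)) := by
      rw [WithLp.smul_snd, WithLp.smul_fst, map_smul, ← smul_sub, smul_comm]
    rw [e]
    exact this
  · have hev : ∀ i, ∀ᶠ h : WithLp 2 (EuclideanSpace ℝ (Fin n) × EuclideanSpace ℝ (Fin n)) in 𝓝 0,
        (SignRel (x i + h.fst i)
          (lassoSlope A b μ x y i + ((1 / μ) • (h.snd - gram A h.fst)) i) ↔
          (h.fst i, ((1 / μ) • (h.snd - gram A h.fst)) i) ∈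
            signTangent (x i) (lassoSlope A b μ x y i)) := by
      intro i
      have hc : Continuous fun h : WithLp 2 (EuclideanSpace ℝ (Fin n) × EuclideanSpace ℝ (Fin n)) =>
          (h.fst i, ((1 / μ) • (h.snd - gram A h.fst)) i) := by
        have h1 := continuous_gram (A := A)
        have h2 := WithLp.prod_continuous_ofLp 2 (EuclideanSpace ℝ (Fin n))
          (EuclideanSpace ℝ (Fin n))
        have h3 : Continuous fun h : WithLp 2 (EuclideanSpace ℝ (Fin n) ×
          EuclideanSpace ℝ (Fin n)) => h.fst := continuous_fst.comp h2
        have h4 : Continuous fun h : WithLp 2 (EuclideanSpace ℝ (Fin n) ×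
          EuclideanSpace ℝ (Fin n)) => h.snd := continuous_snd.comp h2
        have h5 : Continuous fun h : WithLp 2 (EuclideanSpace ℝ (Fin n) ×
          EuclideanSpace ℝ (Fin n)) => h.snd - gram A h.fst := h4.sub (h1.comp h3)
        fun_prop
      have ht := hc.tendsto 0
      simp only [WithLp.zero_fst, WithLp.zero_snd, map_zero, sub_zero, smul_zero,
        PiLp.zero_apply] at ht
      exact ht.eventually (eventually_signRel_iff (hy i))
    filter_upwards [eventually_all.2 hev] with h hh
    change y + h.snd ∈ lassoSubgradient A b μ (x + h.fst) ↔ _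
    rw [mem_lassoSubgradient_iff hμ, lassoSlope_add]
    exact forall_congr' hh

/-- This is the adjoint of the coordinate change: symmetry of the Gram operator moves it from h to
q, and normals become planar ones up to the factor μ. -/
theorem inner_toLp_lasso (hμ : 0 < μ) (q h : WithLp 2 (EuclideanSpace ℝ (Fin n) ×
    EuclideanSpace ℝ (Fin n))) :
    inner ℝ q h = μ * ∑ i, ((1 / μ * (q.fst + gram A q.snd) i) * h.fst i +
      q.snd i * ((1 / μ) • (h.snd - gram A h.fst)) i) := by
  have h1 : inner ℝ q h = inner ℝ (q.fst + gram A q.snd) h.fst +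
      inner ℝ q.snd (h.snd - gram A h.fst) := by
    rw [WithLp.prod_inner_apply, inner_add_left, inner_sub_right, inner_gram_comm]
    change inner ℝ q.fst h.fst + inner ℝ q.snd h.snd = _
    ring
  rw [h1, PiLp.inner_apply, PiLp.inner_apply, ← Finset.sum_add_distrib, Finset.mul_sum]
  refine Finset.sum_congr rfl fun i _ => ?_
  simp only [RCLike.inner_apply, conj_trivial, PiLp.smul_apply, smul_eq_mul]
  field_simp

/-- The polar of a product of cones splits, because each factor contains 0 and test vectors can be
supported in one coordinate. -/
theorem mem_regularNormalCone_lasso_iff (hμ : 0 < μ) {x y : EuclideanSpace ℝ (Fin n)}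
    (hy : y ∈ lassoSubgradient A b μ x)
    (q : WithLp 2 (EuclideanSpace ℝ (Fin n) × EuclideanSpace ℝ (Fin n))) :
    q ∈ regularNormalCone (gph (lassoSubgradient A b μ)) (WithLp.toLp 2 (x, y)) ↔
      ∀ i, (1 / μ * (q.fst + gram A q.snd) i, q.snd i) ∈
        signPolar (x i) (lassoSlope A b μ x y i) := by
  rw [(isLocalCone_lassoTangent hμ hy).mem_regularNormalCone_iff hy]
  constructor
  · rintro h i ⟨s, c⟩ hsc
    -- The second component of the test vector is chosen so that the coordinate change sends it to
    -- (s e_i, c e_i).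
    have e : (1 / μ) • (gram A (EuclideanSpace.single i s) + μ • EuclideanSpace.single i c -
        gram A (EuclideanSpace.single i s)) = EuclideanSpace.single i c := by
      rw [add_sub_cancel_left, smul_smul, one_div_mul_cancel hμ.ne', one_smul]
    obtain ⟨k, hk1, hk2⟩ : ∃ k : WithLp 2 (EuclideanSpace ℝ (Fin n) × EuclideanSpace ℝ (Fin n)),
        k.fst = EuclideanSpace.single i s ∧
        k.snd = gram A (EuclideanSpace.single i s) + μ • EuclideanSpace.single i c :=
      ⟨WithLp.toLp 2 (_, _), rfl, rfl⟩
    rw [← hk2, ← hk1] at e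
    have h1 := h k (by
      intro j
      rw [e, hk1]
      rcases eq_or_ne j i with rfl | hj
      · simpa using hsc
      · have h0 : (EuclideanSpace.single i s j, EuclideanSpace.single i c j) = (0 : ℝ × ℝ) := by
          simp [hj]
        rw [h0]
        exact zero_mem_signTangent _ _)
    rw [inner_toLp_lasso (A := A) hμ, e, hk1,
      Finset.sum_eq_single i (fun j _ hj => by simp [hj]) (by simp)] at h1
    have h2 := nonpos_of_mul_nonpos_right h1 hμ
    simpa using h2
  · intro h k hk
    rw [inner_toLp_lasso (A := A) hμ]
    exact mul_nonpos_of_nonneg_of_nonpos hμ.le (Finset.sum_nonpos fun i _ => h i _ (hk i))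

/-- One inclusion combines closedness of `lassoG` with the local inclusion of planar normals. For
the other, planar sequences are chosen coordinatewise and the y-components are rebuilt from the
slopes, with q constant. -/
theorem mem_limitingNormalCone_lasso_iff (hμ : 0 < μ) {x y : EuclideanSpace ℝ (Fin n)}
    (hy : y ∈ lassoSubgradient A b μ x)
    (q : WithLp 2 (EuclideanSpace ℝ (Fin n) × EuclideanSpace ℝ (Fin n))) :
    q ∈ limitingNormalCone (gph (lassoSubgradient A b μ)) (WithLp.toLp 2 (x, y)) ↔
      ∀ i, (1 / μ * (q.fst + gram A q.snd) i, q.snd i) ∈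
        lassoG (x i) (lassoSlope A b μ x y i) := by
  have hc2 := WithLp.prod_continuous_ofLp 2 (EuclideanSpace ℝ (Fin n)) (EuclideanSpace ℝ (Fin n))
  have hy' := (mem_lassoSubgradient_iff hμ).1 hy
  constructor
  · rintro ⟨-, zs, vs, hzs, hvs, hN⟩ i
    have hz : Tendsto (fun k => ((zs k).fst, (zs k).snd)) atTop (𝓝 (x, y)) :=
      (hc2.tendsto _).comp hzs
    have hv : Tendsto (fun k => ((vs k).fst, (vs k).snd)) atTop (𝓝 (q.fst, q.snd)) :=
      (hc2.tendsto _).comp hvs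
    have hz' : Tendsto (fun k => ((zs k).fst i, lassoSlope A b μ (zs k).fst (zs k).snd i)) atTop
        (𝓝 (x i, lassoSlope A b μ x y i)) := by
      have hc : Continuous fun z : EuclideanSpace ℝ (Fin n) × EuclideanSpace ℝ (Fin n) =>
          (z.1 i, lassoSlope A b μ z.1 z.2 i) := by
        have := continuous_lassoSlope (A := A) (b := b) (μ := μ)
        fun_prop
      exact (hc.tendsto (x, y)).comp hz
    have hv' : Tendsto (fun k => (1 / μ * ((vs k).fst + gram A (vs k).snd) i, (vs k).snd i)) atTop
        (𝓝 (1 / μ * (q.fst + gram A q.snd) i, q.snd i)) := by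
      have hc : Continuous fun z : EuclideanSpace ℝ (Fin n) × EuclideanSpace ℝ (Fin n) =>
          (1 / μ * (z.1 + gram A z.2) i, z.2 i) := by
        have := continuous_gram (A := A)
        fun_prop
      exact (hc.tendsto (q.fst, q.snd)).comp hv
    refine (isClosed_lassoG (hy' i)).mem_of_tendsto hv' ?_
    filter_upwards [hz'.eventually (eventually_signPolar_subset (hy' i))] with k hk
    have hzk : (zs k).snd ∈ lassoSubgradient A b μ (zs k).fst := (hN k).1
    exact hk ((mem_lassoSubgradient_iff hμ).1 hzk i)
      ((mem_regularNormalCone_lasso_iff hμ hzk _).1 (hN k) i)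
  · intro h
    choose ts ps hts hps hmem using fun i => exists_seq_mem_signPolar (hy' i) (h i)
    set xs : ℕ → EuclideanSpace ℝ (Fin n) := fun k => WithLp.toLp 2 fun i => ts i k with hxs
    set rs : ℕ → EuclideanSpace ℝ (Fin n) := fun k => WithLp.toLp 2 fun i => ps i k with hrs
    set ys : ℕ → EuclideanSpace ℝ (Fin n) := fun k =>
      Aᵀ.toEuclideanLin (A.toEuclideanLin (xs k) - b) + μ • rs k with hys
    have hslope : ∀ k, lassoSlope A b μ (xs k) (ys k) = rs k := fun k => by
      rw [lassoSlope, hys, add_sub_cancel_left, smul_smul, one_div_mul_cancel hμ.ne', one_smul]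
    have hxlim : Tendsto xs atTop (𝓝 x) :=
      ((PiLp.continuous_toLp 2 _).tendsto (fun i => x i)).comp (tendsto_pi_nhds.2 hts)
    have hrlim : Tendsto rs atTop (𝓝 (lassoSlope A b μ x y)) :=
      ((PiLp.continuous_toLp 2 _).tendsto (fun i => lassoSlope A b μ x y i)).comp
        (tendsto_pi_nhds.2 hps)
    have hylim : Tendsto ys atTop (𝓝 y) := by
      have e : y = Aᵀ.toEuclideanLin (A.toEuclideanLin x - b) + μ • lassoSlope A b μ x y := by
        rw [lassoSlope, smul_smul, mul_one_div_cancel hμ.ne', one_smul]; abel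
      have h1 : Continuous A.toEuclideanLin := LinearMap.continuous_of_finiteDimensional _
      have h2 : Continuous Aᵀ.toEuclideanLin := LinearMap.continuous_of_finiteDimensional _
      have h3 := ((h2.tendsto _).comp (((h1.tendsto _).comp hxlim).sub_const b)).add
        (hrlim.const_smul μ)
      rwa [← e] at h3
    refine ⟨hy, fun k => WithLp.toLp 2 (xs k, ys k), fun _ => q, ?_, tendsto_const_nhds,
      fun k => ?_⟩
    · exact ((WithLp.prod_continuous_toLp 2 _ _).tendsto (x, y)).comp (hxlim.prodMk_nhds hylim)
    · have hk : ys k ∈ lassoSubgradient A b μ (xs k) := by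
        rw [mem_lassoSubgradient_iff hμ, hslope]
        exact fun i => (hmem i k).1
      rw [mem_regularNormalCone_lasso_iff hμ hk, hslope]
      exact fun i => (hmem i k).2

theorem coderivative_lassoSubgradient (hμ : 0 < μ) {x y : EuclideanSpace ℝ (Fin n)}
    (hy : y ∈ lassoSubgradient A b μ x) (v : EuclideanSpace ℝ (Fin n)) :
    coderivative (lassoSubgradient A b μ) x y v =
      {w | ∀ i, (1 / μ * (w - gram A v) i, -v i) ∈ lassoG (x i) (lassoSlope A b μ x y i)} := by
  ext w
  have h := mem_limitingNormalCone_lasso_iff hμ hy (WithLp.toLp 2 (w, -v))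
  rw [WithLp.toLp_fst, WithLp.toLp_snd, map_neg, ← sub_eq_add_neg] at h
  exact h

/-! ### The Newton step and convergence -/

/-- The Newton inclusion is solvable at every point of the graph. -/
theorem exists_mem_coderivative_lasso (hμ : 0 < μ) (hA : Function.Injective A.toEuclideanLin)
    {x y : EuclideanSpace ℝ (Fin n)} (hy : y ∈ lassoSubgradient A b μ x)
    (w : EuclideanSpace ℝ (Fin n)) :
    ∃ d, w ∈ coderivative (lassoSubgradient A b μ) x y d := by
  classical
  -- L imposes the Gram equation on the support of x and d_i = 0 elsewhere. This suffices, since at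
  -- t = 0 every admissible `lassoG` contains the pairs with second entry 0.
  let L : EuclideanSpace ℝ (Fin n) →ₗ[ℝ] EuclideanSpace ℝ (Fin n) :=
    { toFun := fun d => WithLp.toLp 2 fun i => if x i ≠ 0 then gram A d i else d i
      map_add' := fun d e => by ext i; by_cases h : x i = 0 <;> simp [h]
      map_smul' := fun s d => by ext i; by_cases h : x i = 0 <;> simp [h] }
  have hL : ∀ d i, L d i = if x i ≠ 0 then gram A d i else d i := fun d i => rfl
  have hinj : Function.Injective L := by
    rw [← LinearMap.ker_eq_bot, LinearMap.ker_eq_bot']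
    intro d hd
    -- On the kernel of L, each coordinate has (AᵀAd)_i = 0 or d_i = 0, so ⟨AᵀAd, d⟩ vanishes
    -- termwise.
    refine eq_zero_of_inner_gram_nonpos hA (le_of_eq ?_)
    rw [PiLp.inner_apply]
    refine Finset.sum_eq_zero fun i _ => ?_
    have hi := hL d i
    rw [hd, PiLp.zero_apply] at hi
    by_cases h : x i = 0
    · simp only [h, ne_eq, not_true_eq_false, if_false] at hi
      simp [← hi]
    · simp only [ne_eq, h, not_false_eq_true, if_true] at hi
      simp [← hi]
  obtain ⟨d, hd⟩ := LinearMap.injective_iff_surjective.1 hinj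
    (WithLp.toLp 2 fun i => if x i ≠ 0 then w i else 0)
  refine ⟨d, ?_⟩
  rw [coderivative_lassoSubgradient hμ hy]
  intro i
  have hr := (mem_lassoSubgradient_iff hμ).1 hy i
  have hi := hL d i
  rw [hd] at hi
  by_cases h : x i = 0
  · have hdi : d i = 0 := by simpa [h] using hi.symm
    rw [hdi]
    rcases hr.cases with h1 | h1 | h1 | h1 | h1
    · exact absurd h h1.1.ne'
    · exact absurd h h1.1.ne
    · rw [h, lassoG_of_mem_Ioo h1.2.1 h1.2.2]; simp
    · rw [h, h1.2, lassoG_one]; simp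
    · rw [h, h1.2, lassoG_neg_one]; simp
  · have hdi : gram A d i = w i := by simpa [h] using hi.symm
    have hp : lassoSlope A b μ x y i = -1 ∨ lassoSlope A b μ x y i = 1 := by
      rcases hr.cases with h1 | h1 | h1 | h1 | h1
      · exact Or.inr h1.2
      · exact Or.inl h1.2
      · exact absurd h1.1 h
      · exact absurd h1.1 h
      · exact absurd h1.1 h
    rw [lassoG_of_ne h hp]
    simp [hdi]

/-- Near the solution, one Newton step from a point of the graph reaches the solution. -/
theorem eventually_newton_step_eq (hμ : 0 < μ) (hA : Function.Injective A.toEuclideanLin)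
    {x₀ : EuclideanSpace ℝ (Fin n)} (h₀ : 0 ∈ lassoSubgradient A b μ x₀) :
    ∀ᶠ z : EuclideanSpace ℝ (Fin n) × EuclideanSpace ℝ (Fin n) in 𝓝 (x₀, 0),
      z.2 ∈ lassoSubgradient A b μ z.1 →
      ∀ d, -z.2 ∈ coderivative (lassoSubgradient A b μ) z.1 z.2 d → z.1 + d = x₀ := by
  have h₀' := (mem_lassoSubgradient_iff hμ).1 h₀
  have hev : ∀ i, ∀ᶠ z : EuclideanSpace ℝ (Fin n) × EuclideanSpace ℝ (Fin n) in 𝓝 (x₀, 0),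
      SignRel (z.1 i) (lassoSlope A b μ z.1 z.2 i) → ∀ a d,
        (a, -d) ∈ lassoG (z.1 i) (lassoSlope A b μ z.1 z.2 i) →
        0 ≤ (a + (lassoSlope A b μ z.1 z.2 i - lassoSlope A b μ x₀ 0 i)) * (z.1 i + d - x₀ i) := by
    intro i
    have hc : Continuous fun z : EuclideanSpace ℝ (Fin n) × EuclideanSpace ℝ (Fin n) =>
        (z.1 i, lassoSlope A b μ z.1 z.2 i) := by
      have := continuous_lassoSlope (A := A) (b := b) (μ := μ)
      fun_prop
    exact (hc.tendsto (x₀, 0)).eventually (eventually_newton_coord_nonneg (h₀' i))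
  filter_upwards [eventually_all.2 hev] with ⟨x, y⟩ hz hy d hd
  simp only at hz hy hd ⊢
  rw [coderivative_lassoSubgradient hμ hy] at hd
  have hy' := (mem_lassoSubgradient_iff hμ).1 hy
  suffices x + d - x₀ = 0 from sub_eq_zero.1 this
  refine eq_zero_of_inner_gram_nonpos hA ?_
  have hs : lassoSlope A b μ x y = lassoSlope A b μ x₀ 0 + (1 / μ) • (y - gram A (x - x₀)) := by
    rw [← lassoSlope_add, zero_add, add_sub_cancel]
  rw [PiLp.inner_apply]
  refine Finset.sum_nonpos fun i _ => ?_
  have h1 := hz i (hy' i) _ _ (hd i)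
  -- The residual y cancels, and the first factor of the scalar inequality becomes a negative
  -- multiple of the Gram image of the new error.
  have e : 1 / μ * (-y - gram A d) i + (lassoSlope A b μ x y i - lassoSlope A b μ x₀ 0 i) =
      -(1 / μ * gram A (x + d - x₀) i) := by
    have e1 : x + d - x₀ = (x - x₀) + d := by abel
    rw [hs, e1, map_add]
    simp only [PiLp.add_apply, PiLp.sub_apply, PiLp.neg_apply, PiLp.smul_apply, smul_eq_mul]
    ring
  rw [e, neg_mul, mul_assoc] at h1
  have h2 := nonpos_of_mul_nonpos_right (neg_nonneg.1 h1) (by positivity)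
  simp only [RCLike.inner_apply, conj_trivial, PiLp.sub_apply, PiLp.add_apply] at h2 ⊢
  linarith

theorem newtonIter_lasso_exists (hμ : 0 < μ) (hA : Function.Injective A.toEuclideanLin) {lam : ℝ}
    (hlam : 0 < lam) (x : EuclideanSpace ℝ (Fin n)) :
    ∃ x', NewtonIter (lasso A b μ) lam x x' := by
  by_cases h : 0 ∈ subdifferential (lasso A b μ) x
  · exact ⟨x, Or.inl ⟨h, rfl⟩⟩
  · obtain ⟨p, hp⟩ := exists_mem_prox_lasso (b := b) hμ hA hlam x
    have hv := (mem_prox_lasso_iff hμ hlam).1 hp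
    set v := (1 / lam) • (x - p) with hvdef
    have hxp : x - lam • v = p := by
      rw [hvdef, smul_smul, mul_one_div_cancel hlam.ne', one_smul]; abel
    obtain ⟨d, hd⟩ := exists_mem_coderivative_lasso hμ hA hv (-v)
    -- The inclusion constrains λv plus the chosen direction, so a solution d is shifted by -λv.
    refine ⟨x + (d - lam • v), Or.inr ⟨h, p, hp, v, d - lam • v, rfl, ?_, rfl⟩⟩
    rw [hxp, add_sub_cancel, secondSubdifferential, subdifferential_lasso hμ]
    exact hd

theorem newtonWellDefined_lasso (hμ : 0 < μ) (hA : Function.Injective A.toEuclideanLin) {lam : ℝ}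
    (hlam : 0 < lam) (x : EuclideanSpace ℝ (Fin n)) :
    NewtonWellDefined (lasso A b μ) lam x := by
  refine ⟨by rw [startSet_lasso hμ hA hlam]; trivial, fun xs N _ _ => ⟨?_, ?_⟩⟩
  · exact existsUnique_mem_prox_lasso hμ hA hlam _
  · exact newtonIter_lasso_exists hμ hA hlam _

/-- Starting near the minimizer, a single pass of the algorithm reaches the minimizer. -/
theorem eventually_newtonIter_lasso_eq (hμ : 0 < μ) (hA : Function.Injective A.toEuclideanLin)
    {lam : ℝ} (hlam : 0 < lam) {x₀ : EuclideanSpace ℝ (Fin n)}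
    (h₀ : 0 ∈ lassoSubgradient A b μ x₀) :
    ∀ᶠ x in 𝓝 x₀, ∀ x', NewtonIter (lasso A b μ) lam x x' → x' = x₀ := by
  choose P hP using fun x => exists_mem_prox_lasso (b := b) hμ hA hlam x
  have hfix : x₀ ∈ prox (lasso A b μ) lam x₀ := by
    rw [mem_prox_lasso_iff hμ hlam, sub_self, smul_zero]; exact h₀
  have hPlim : Tendsto P (𝓝 x₀) (𝓝 x₀) := by
    rw [tendsto_iff_norm_sub_tendsto_zero]
    refine squeeze_zero (fun _ => norm_nonneg _)
      -- The minimizer is a fixed point of the proximal mapping, so nonexpansiveness gives P x → x₀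
      -- and makes the residual tend to 0.
      (fun x => prox_lasso_nonexpansive hμ hlam hfix (hP x)) ?_
    exact tendsto_iff_norm_sub_tendsto_zero.1 tendsto_id
  have hlim : Tendsto (fun x => (P x, (1 / lam) • (x - P x))) (𝓝 x₀) (𝓝 (x₀, 0)) := by
    have h1 : Tendsto (fun x => (1 / lam) • (x - P x)) (𝓝 x₀) (𝓝 ((1 / lam) • (x₀ - x₀))) :=
      (tendsto_id.sub hPlim).const_smul _
    rw [sub_self, smul_zero] at h1
    exact hPlim.prodMk_nhds h1
  filter_upwards [hlim.eventually (eventually_newton_step_eq hμ hA h₀)] with x hx x' hx'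
  rcases hx' with ⟨hzero, rfl⟩ | ⟨-, p, hp, v, d, hv, hd, rfl⟩
  · rw [subdifferential_lasso hμ] at hzero
    exact lassoSubgradient_inverse_unique hμ hA h₀ hzero
  · obtain rfl : p = P x := (existsUnique_mem_prox_lasso hμ hA hlam x).unique hp (hP x)
    have hxp : x - lam • v = P x := by
      rw [hv, smul_smul, mul_one_div_cancel hlam.ne', one_smul]; abel
    rw [secondSubdifferential, subdifferential_lasso hμ, hxp] at hd
    rw [hv] at hd
    have := hx ((mem_prox_lasso_iff hμ hlam).1 hp) _ hd
    rw [← hv, ← hxp] at this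
    rw [← this]
    abel

theorem convergesSuperlinearly_lasso (hμ : 0 < μ) (hA : Function.Injective A.toEuclideanLin)
    {lam : ℝ} (hlam : 0 < lam) {x₀ : EuclideanSpace ℝ (Fin n)}
    (h₀ : 0 ∈ lassoSubgradient A b μ x₀) :
    ∀ᶠ x in 𝓝 x₀, ∀ xs : ℕ → EuclideanSpace ℝ (Fin n), xs 0 = x →
      (∀ k, NewtonIter (lasso A b μ) lam (xs k) (xs (k + 1))) → ConvergesSuperlinearly xs x₀ := by
  have hev := eventually_newtonIter_lasso_eq (b := b) hμ hA hlam h₀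
  filter_upwards [hev] with x hx xs hxs hiter
  have hsucc : ∀ k, xs (k + 1) = x₀ := by
    intro k
    induction k with
    | zero => exact hx _ (hxs ▸ hiter 0)
    -- The minimizer belongs to its own good neighborhood, so later passes cannot leave it, whether
    -- or not they stop.
    | succ k ih => exact hev.self_of_nhds _ (ih ▸ hiter (k + 1))
  constructor
  · rw [← tendsto_add_atTop_iff_nat 1]
    simp only [hsucc]
    exact tendsto_const_nhds
  · simp only [hsucc, sub_self]
    exact Asymptotics.isLittleO_zero _ _

/-! ### The diagonal case and the theorem -/

/-- For diagonal A the optimality condition decouples into scalar soft thresholding, with center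
(x_i + a_i b_i)/(a_i² + 1) and threshold μ/(a_i² + 1). -/
theorem mem_prox_lasso_diagonal_iff (hμ : 0 < μ) {A : Matrix (Fin n) (Fin n) ℝ}
    {b : EuclideanSpace ℝ (Fin n)} {a : Fin n → ℝ}
    (ha : A = Matrix.diagonal a) (x p : EuclideanSpace ℝ (Fin n)) :
    p ∈ prox (lasso A b μ) 1 x ↔
      ∀ i, p i = max (|(x i + a i * b i) / (a i ^ 2 + 1)| - μ / (a i ^ 2 + 1)) 0 *
        Real.sign ((x i + a i * b i) / (a i ^ 2 + 1)) := by
  rw [mem_prox_lasso_iff hμ one_pos, mem_lassoSubgradient_iff hμ]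
  refine forall_congr' fun i => ?_
  have hd : 0 < a i ^ 2 + 1 := by positivity
  rw [← signRel_iff_eq_soft_threshold (div_pos hμ hd)]
  have e : lassoSlope A b μ p ((1 / 1 : ℝ) • (x - p)) i =
      ((x i + a i * b i) / (a i ^ 2 + 1) - p i) / (μ / (a i ^ 2 + 1)) := by
    simp only [lassoSlope, ha, Matrix.diagonal_transpose, PiLp.smul_apply, PiLp.sub_apply,
      Matrix.toLpLin_apply, Matrix.mulVec_diagonal, smul_eq_mul]
    field_simp
    ring
  rw [e]

end Lasso

theorem theorem7p4 (m n : ℕ) (A : Matrix (Fin m) (Fin n) ℝ) (b : EuclideanSpace ℝ (Fin m))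
    (μ : ℝ) (hμ : 0 < μ) (hQ : (Aᵀ * A).PosDef) :
    -- explicit formula for the subdifferential
    (∀ x, subdifferential (lasso A b μ) x =
      {y | ∃ v ∈ signSet x, y = Aᵀ.toEuclideanLin (A.toEuclideanLin x - b) + μ • v}) ∧
    -- explicit formula for the second-order subdifferential on the graph
    (∀ x, ∀ y ∈ subdifferential (lasso A b μ) x, ∀ v,
      secondSubdifferential (lasso A b μ) x y v =
        {w | ∀ i, (1 / μ * (w - Aᵀ.toEuclideanLin (A.toEuclideanLin v)) i, -v i) ∈
          lassoG (x i) (1 / μ * (y - Aᵀ.toEuclideanLin (A.toEuclideanLin x - b)) i)}) ∧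
    -- explicit formula for the proximal mapping (`λ = 1`) when `A` is square and diagonal
    (∀ (hmn : m = n) (a : Fin n → ℝ), (∀ i, 0 < a i) →
      (∀ (i : Fin m) (j : Fin n), A i j = if (i : ℕ) = (j : ℕ) then a j else 0) →
      ∀ x p, p ∈ prox (lasso A b μ) 1 x ↔
        ∀ i, p i = max (|(x i + a i * b (Fin.cast hmn.symm i)) / (a i ^ 2 + 1)|
            - μ / (a i ^ 2 + 1)) 0 *
          Real.sign ((x i + a i * b (Fin.cast hmn.symm i)) / (a i ^ 2 + 1))) ∧
    -- strong metric regularity and semismoothness* at every point of the graph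
    (∀ x, ∀ y ∈ subdifferential (lasso A b μ) x,
      IsStronglyMetricallyRegular (subdifferential (lasso A b μ)) x y ∧
      IsSemismoothStar (subdifferential (lasso A b μ)) x y) ∧
    -- `U_λ` is the whole space and the proximal mapping is single-valued, for every `λ > 0`
    (∀ lam : ℝ, 0 < lam → startSet (lasso A b μ) lam = univ ∧
      ∀ x, ∃! p, p ∈ prox (lasso A b μ) lam x) ∧
    -- optimal solutions exist and are the solutions of the subgradient inclusion
    (∃ x, IsMinOn (lasso A b μ) univ x) ∧
    (∀ x, IsMinOn (lasso A b μ) univ x ↔ 0 ∈ subdifferential (lasso A b μ) x) ∧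
    ∀ xbar, IsMinOn (lasso A b μ) univ xbar →
      -- the assumptions of the local convergence result hold at the optimal solution
      (IsRobustlySolvable (lasso A b μ) xbar 0 ∧
        IsMetricallyRegular (subdifferential (lasso A b μ)) xbar 0 ∧
        IsSemismoothStar (subdifferential (lasso A b μ)) xbar 0 ∧
        IsProxBounded (lasso A b μ) ∧
        IsProxRegular (lasso A b μ) xbar 0 ∧
        IsSubdifferentiallyContinuous (lasso A b μ) xbar 0) ∧
      -- well-definedness and superlinear convergence of the algorithm
      ∀ lam : ℝ, 0 < lam → ∃ U ∈ 𝓝 xbar, ∀ x₀ ∈ U,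
        NewtonWellDefined (lasso A b μ) lam x₀ ∧
        ∀ xs : ℕ → EuclideanSpace ℝ (Fin n), xs 0 = x₀ →
          (∀ k, NewtonIter (lasso A b μ) lam (xs k) (xs (k + 1))) →
          ConvergesSuperlinearly xs xbar := by
  have hA := injective_of_posDef hQ
  have hsub := subdifferential_lasso (A := A) (b := b) hμ
  have hcvx := convexOn_lasso (A := A) (b := b) hμ
  have hcod : ∀ x y v, secondSubdifferential (lasso A b μ) x y v =
      coderivative (lassoSubgradient A b μ) x y v := fun x y v => by
    rw [secondSubdifferential, hsub]
  have hreg := isStronglyMetricallyRegular_lassoSubgradient (b := b) hμ hA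
  have hsemi : ∀ x, ∀ y ∈ lassoSubgradient A b μ x, IsSemismoothStar (lassoSubgradient A b μ) x y :=
    fun x y hy => isSemismoothStar_of_isLocalCone (isLocalCone_lassoTangent hμ hy)
  refine ⟨fun x => by rw [hsub]; rfl, fun x y hy v => ?_, ?_, fun x y hy => ?_,
    fun lam hlam => ⟨startSet_lasso hμ hA hlam, existsUnique_mem_prox_lasso hμ hA hlam⟩, ?_,
    fun x => isMinOn_iff_zero_mem_subdifferential hcvx, fun xbar hmin => ?_⟩
  · rw [hsub] at hy
    rw [hcod, coderivative_lassoSubgradient hμ hy]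
    rfl
  · rintro rfl a - hAa x p
    refine mem_prox_lasso_diagonal_iff hμ ?_ x p
    ext i j
    rw [hAa, Matrix.diagonal_apply]
    by_cases h : i = j
    · simp [h]
    · simp [h, Fin.val_ne_of_ne h]
  · rw [hsub] at hy ⊢
    exact ⟨hreg x y, hsemi x y hy⟩
  · obtain ⟨x, hx⟩ := lassoSubgradient_surjective (b := b) hμ hA 0
    exact ⟨x, (isMinOn_iff_zero_mem_subdifferential hcvx).2 (hsub ▸ hx)⟩
  · have h0 : 0 ∈ lassoSubgradient A b μ xbar := by
      rw [← hsub]; exact (isMinOn_iff_zero_mem_subdifferential hcvx).1 hmin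
    refine ⟨⟨?_, ?_, ?_, ?_, ?_, ?_⟩, fun lam hlam => ?_⟩
    · refine ⟨univ, univ_mem, univ, univ_mem, fun x _ v _ hv => ?_⟩
      rw [hsub] at hv
      simp only [hcod]
      exact exists_mem_coderivative_lasso hμ hA hv (-v)
    · rw [hsub]; exact (hreg xbar 0).1
    · rw [hsub]; exact hsemi xbar 0 h0
    · refine ⟨0, 0, 0, fun x => ?_⟩
      simp only [inner_zero_left, zero_mul, add_zero, sub_zero]
      unfold lasso
      have : 0 ≤ ∑ i, |x i| := Finset.sum_nonneg fun i _ => abs_nonneg _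
      positivity
    · refine ⟨Eventually.of_forall fun x => continuous_lasso.lowerSemicontinuous x, 1, one_pos, 1,
        one_pos, fun x _ u _ _ v hv => ?_⟩
      -- Convexity gives the bound without the quadratic term, so ε = r = 1 are arbitrary choices.
      have := (mem_subdifferential_iff_of_convexOn hcvx).1 hv.1 x
      nlinarith [sq_nonneg ‖x - u‖]
    · intro xs _ hxs _ _
      exact (continuous_lasso.tendsto xbar).comp hxs
    · exact ⟨_, convergesSuperlinearly_lasso hμ hA hlam h0, fun x hx =>
        ⟨newtonWellDefined_lasso hμ hA hlam x, hx⟩⟩
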